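/- A hypergraph consists of a finite vertex set and a set of edges, each of which is a subset of the vertex set. It is an $r$-graph if every edge has exactly $r$ vertices, and it is linear if any two distinct edges have at most one vertex in common. For $r,\ell\ge 3$, the $r$-uniform linear cycle $C^r_\ell$ of length $\ell$ is the $r$-graph (unique up to isomorphism) with $\ell$ distinct edges $e_1,\dots,e_\ell$ such that $|e_i\cap e_{i+1}|=1$ for $1\le i\le \ell-1$, $|e_\ell\cap e_1|=1$, $e_i\cap e_j=\emptyset$ for all other pairs $i\ne j$, and no vertex lies in three of the edges (the last condition matters only for $\ell=3$), and whose vertex set is $e_1\cup\dots\cup e_\ell$. Let $\mathrm{ex}_L(n,C^r_\ell)$ denote the maximum number of edges of a linear $r$-graph on $n$ vertices that contains no subgraph isomorphic to $C^r_\ell$. **Theorem.** For all integers $r,\ell\ge 3$ there is a constant $\alpha_{r,\ell}>0$, depending only on $r$ and $\ell$, such that for all $n$ $$\mathrm{ex}_L(n,C^r_\ell)\le \alpha_{r,\ell}\, n^{1+\frac{1}{\lfloor \ell/2\rfloor}}.$$ -/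

import Mathlib

namespace Hypergraph

variable {V : Type*}

/-- `H` is `r`-uniform (an `r`-graph): every edge has exactly `r` vertices. -/
def IsUniform (H : Hypergraph V) (r : ℕ) : Prop :=
  ∀ e ∈ H.edgeSet, e.encard = r

/-- `H` is linear: two different edges have at most one common vertex. -/
def IsLinear (H : Hypergraph V) : Prop :=
  ∀ e ∈ H.edgeSet, ∀ f ∈ H.edgeSet, e ≠ f → (e ∩ f).encard ≤ 1

/-- `H` is a subgraph of `G`. -/
def IsSubgraph (H G : Hypergraph V) : Prop :=
  H.vertexSet ⊆ G.vertexSet ∧ H.edgeSet ⊆ G.edgeSet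

/-- `C` is a linear cycle of length `ℓ` (used for `ℓ ≥ 3`): its edges can be listed cyclically,
indexed by `ZMod ℓ`, as `ℓ` different sets such that cyclically consecutive edges meet in exactly
one vertex and any other two edges are disjoint. Its vertices are those of its edges.

The last clause says that no vertex lies in three edges. For `ℓ ≥ 4` it follows from the previous
one; for `ℓ = 3`, where any two edges are consecutive, it excludes three edges through one common
vertex, so that a linear triangle is an expansion of the graph triangle. -/
def IsLinearCycle (C : Hypergraph V) (ℓ : ℕ) : Prop :=
  ∃ e : ZMod ℓ → Set V,
    Function.Injective e ∧
    C.edgeSet = Set.range e ∧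
    C.vertexSet = ⋃ i, e i ∧
    (∀ i, (e i ∩ e (i + 1)).encard = 1) ∧
    (∀ i j, i ≠ j → j ≠ i + 1 → i ≠ j + 1 → Disjoint (e i) (e j)) ∧
    (∀ i j k, i ≠ j → j ≠ k → i ≠ k → e i ∩ e j ∩ e k = ∅)

/-- `G` contains a copy of `C^r_ℓ`: some subgraph of `G` is an `r`-uniform linear cycle of
length `ℓ`. -/
def ContainsLinearCycle (G : Hypergraph V) (r ℓ : ℕ) : Prop :=
  ∃ C : Hypergraph V, C.IsSubgraph G ∧ C.IsUniform r ∧ C.IsLinearCycle ℓ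

/-- The numbers of edges of the linear `r`-graphs on `n` vertices that contain no `C^r_ℓ`. -/
def linearCycleFreeSizes (n r ℓ : ℕ) : Set ℕ :=
  {k | ∃ G : Hypergraph (Fin n), G.vertexSet = Set.univ ∧ G.IsUniform r ∧ G.IsLinear ∧
    ¬ G.ContainsLinearCycle r ℓ ∧ G.edgeSet.ncard = k}

/-- The linear Turán number `ex_L(n, C^r_ℓ)`: the maximum number of edges of a linear `r`-graph on
`n` vertices that contains no `C^r_ℓ`. The supremum is an attained maximum, see
`isGreatest_linearTuranCycle`. -/
noncomputable def linearTuranCycle (n r ℓ : ℕ) : ℕ :=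
  sSup (linearCycleFreeSizes n r ℓ)

theorem isGreatest_linearTuranCycle (n r ℓ : ℕ) :
    IsGreatest (linearCycleFreeSizes n r ℓ) (linearTuranCycle n r ℓ) := by
  have hne : (linearCycleFreeSizes n r ℓ).Nonempty := by
    refine ⟨0, Hypergraph.trivialOn Set.univ, rfl, ?_, ?_, ?_, ?_⟩
    · intro e he; simp at he
    · intro e he; simp at he
    · rintro ⟨C, ⟨-, hC⟩, -, e, -, he, -⟩
      have h : e 0 ∈ C.edgeSet := by rw [he]; exact ⟨0, rfl⟩
      simpa using hC h
    · simp
  have hb : BddAbove (linearCycleFreeSizes n r ℓ) := by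
    refine ⟨(Set.univ : Set (Set (Fin n))).ncard, ?_⟩
    rintro k ⟨G, -, -, -, -, rfl⟩
    exact Set.ncard_le_ncard (Set.subset_univ _) (Set.toFinite _)
  exact ⟨Nat.sSup_mem hne hb, fun k hk => le_csSup hb hk⟩

end Hypergraph

/-! Put m = ⌊ℓ/2⌋. A core of the r-graph has minimum degree d at least |E|/n. Fix a vertex x of it
and let R_i be the set of vertices with a linear path of length i to x. If |R_{i+1}| ≥ (d/C)|R_i|
for all i < m, then d^m ≤ C^m n, which is the bound. The sets R_i may overlap; only their growth
matters (`card_reach_mul_le`, `degree_pow_le`).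

If growth fails at step i, choose a path P(u) of length i to x for each u in A = R_i. By linearity,
most edges through u meet P(u) only in u, and all their other vertices lie in T = R_{i+1}. These
edges form a system that is dense compared with |A| + |T|, and in it a cycle of length exactly ℓ is
built from a path W that starts in A and returns to A, together with parts of the two chosen paths
at its ends.

The difficulty is to control where these two paths first meet. Vertices of a path are marked with
their positions. For each endpoint b, `exists_spread` keeps a constant fraction of the edges f at b
so that the paths P(a f) share a set κ(b) of marks, while every other mark lies on few of them. A
core with respect to the incidences (a f, κ(b f)) and b f allows W to grow greedily with κ constant,
equal to some τ contained in the marks of P(u) (`exists_path_of_dense`). The last edge can then be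
chosen so that its path shares with P(u) exactly the marks in τ (`hasCycle_of_spread`). So the
number h of edges before the meeting is known before the length of W is fixed, and W with its last
edge is given 2(m - h) edges, for a total of 2m. For odd ℓ one more edge is inserted from b f to a
third vertex c f, and spreading is done first over c and then over b (`hasCycle_odd_of_dense`). -/

namespace LinearPath

/-! ### Linear paths and positions on them -/

variable {V : Type*} [DecidableEq V]

/-- Two different members of `E` have at most one common vertex. -/
def Linear (E : Finset (Finset V)) : Prop :=
  ∀ e ∈ E, ∀ f ∈ E, ∀ v w, v ≠ w → v ∈ e → w ∈ e → v ∈ f → w ∈ f → e = f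

/-- First vertex of a path with last vertex `y`. A path is given by the list of its edges, each
with the vertex through which the path enters it. -/
def head (y : V) : List (V × Finset V) → V
  | [] => y
  | (v, _) :: _ => v

/-- The vertices covered by a path with last vertex `y`. -/
def supp (y : V) : List (V × Finset V) → Finset V
  | [] => {y}
  | (_, e) :: p => e ∪ supp y p

/-- Linear paths with edges in `E` and last vertex `y`. -/
def IsPath (E : Finset (Finset V)) (y : V) : List (V × Finset V) → Prop
  | [] => True
  | (v, e) :: p => e ∈ E ∧ v ∈ e ∧ head y p ∈ e ∧ v ≠ head y p ∧
      (∀ w ∈ e, w ∈ supp y p → w = head y p) ∧ IsPath E y p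

/-- The position of a vertex on a path: `2 * k` for the vertex entering edge number `k`,
`2 * k + 1` for a vertex of that edge only. -/
def lab (y : V) : List (V × Finset V) → V → ℕ
  | [], _ => 0
  | (v, _) :: p, w => if w = v then 0 else if w ∈ supp y p then lab y p w + 2 else 1

/-- Edge number `i` of a path, and `∅` beyond the end. -/
def edge : List (V × Finset V) → ℕ → Finset V
  | [], _ => ∅
  | (_, e) :: _, 0 => e
  | _ :: p, i + 1 => edge p i

/-- `E` contains the edges of a linear cycle of length `ℓ`. -/
def HasCycle (E : Finset (Finset V)) (ℓ : ℕ) : Prop :=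
  ∃ e : ℕ → Finset V, (∀ i < ℓ, e i ∈ E) ∧ (∀ i, i + 1 < ℓ → (e i ∩ e (i + 1)).card = 1) ∧
    (e (ℓ - 1) ∩ e 0).card = 1 ∧
    (∀ i j, i + 1 < j → j < ℓ → ¬ (i = 0 ∧ j + 1 = ℓ) → Disjoint (e i) (e j)) ∧
    (∀ i j k, i < j → j < k → k < ℓ → e i ∩ e j ∩ e k = ∅)

variable {E : Finset (Finset V)} {x y : V} {p q : List (V × Finset V)}

theorem head_mem_supp (h : IsPath E y p) : head y p ∈ supp y p := by
  cases p with
  | nil => simp [head, supp]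
  | cons a p => simp only [head, supp, Finset.mem_union]; exact Or.inl h.2.1

theorem root_mem_supp (y : V) (p : List (V × Finset V)) : y ∈ supp y p := by
  induction p with
  | nil => simp [supp]
  | cons a p ih => simp [supp, ih]

theorem head_ne_root (h : IsPath E y p) (hp : p ≠ []) : head y p ≠ y := by
  cases p with
  | nil => exact absurd rfl hp
  | cons a p =>
    intro h'
    simp only [head] at h'
    have := h.2.2.2.2.1 a.1 h.2.1 (h' ▸ root_mem_supp y p)
    exact h.2.2.2.1 this

theorem head_notMem_tail {a : V × Finset V} (h : IsPath E y (a :: p)) : a.1 ∉ supp y p :=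
  fun h' => h.2.2.2.1 (h.2.2.2.2.1 a.1 h.2.1 h')

theorem supp_card_le {r : ℕ} (hr : ∀ e ∈ E, e.card = r) (h : IsPath E y p) :
    (supp y p).card ≤ r * p.length + 1 := by
  induction p with
  | nil => simp [supp]
  | cons a p ih =>
    have h1 := Finset.card_union_le a.2 (supp y p)
    have h2 := ih h.2.2.2.2.2
    have h3 := hr _ h.1
    simp only [supp, List.length_cons]
    rw [mul_add]
    omega

theorem lab_le (y : V) (p : List (V × Finset V)) (w : V) : lab y p w ≤ 2 * p.length := by
  induction p with
  | nil => simp [lab]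
  | cons a p ih =>
    simp only [lab, List.length_cons]
    split_ifs <;> omega

theorem lab_head : lab y p (head y p) = 0 := by
  cases p <;> simp [lab, head]

theorem lab_eq_zero {w : V} (h : w = head y p) : lab y p w = 0 :=
  h ▸ lab_head

theorem eq_head_of_lab {w : V} (hw : w ∈ supp y p) (h : lab y p w = 0) : w = head y p := by
  cases p with
  | nil => simpa [supp, head] using hw
  | cons a p =>
    simp only [lab] at h
    split_ifs at h with h1
    exact h1

theorem lab_cons_of_mem {a : V × Finset V} (h : IsPath E y (a :: p)) {w : V}
    (hw : w ∈ supp y p) : lab y (a :: p) w = lab y p w + 2 := by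
  have : w ≠ a.1 := fun h' => head_notMem_tail h (h' ▸ hw)
  simp [lab, this, hw]

theorem head_append {V : Type*} {x y : V} {p q : List (V × Finset V)} (hq : head x q = y) : head x (p ++ q) = head y p := by
  cases p with
  | nil => simpa [head] using hq
  | cons a p => simp [head]

theorem supp_append (hq : y ∈ supp x q) : supp x (p ++ q) = supp y p ∪ supp x q := by
  induction p with
  | nil => simp [supp, Finset.insert_eq_of_mem hq]
  | cons a p ih => simp [supp, ih, Finset.union_assoc]

theorem IsPath.append (hp : IsPath E y p) (hq : IsPath E x q) (hy : head x q = y)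
    (h : ∀ w ∈ supp y p, w ∈ supp x q → w = y) : IsPath E x (p ++ q) := by
  have hyq : y ∈ supp x q := hy ▸ head_mem_supp hq
  induction p with
  | nil => simpa using hq
  | cons a p ih =>
    obtain ⟨h1, h2, h3, h4, h5, h6⟩ := hp
    have hsub : ∀ w ∈ supp y p, w ∈ supp x q → w = y := fun w hw =>
      h w (by simp [supp, hw])
    refine ⟨h1, h2, ?_, ?_, ?_, ih h6 hsub⟩
    · change head x (p ++ q) ∈ a.2
      rwa [head_append hy]
    · change a.1 ≠ head x (p ++ q)
      rwa [head_append hy]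
    · intro w hw hw'
      change w = head x (p ++ q)
      rw [head_append hy]
      have hw'' : w ∈ supp x (p ++ q) := hw'
      rw [supp_append hyq, Finset.mem_union] at hw''
      rcases hw'' with h' | h'
      · exact h5 w hw h'
      · have hwy : w = y := h w (by simp only [supp, Finset.mem_union]; exact Or.inl hw) h'
        subst hwy
        exact h5 w hw (root_mem_supp _ _)

theorem edge_subset_supp (p : List (V × Finset V)) (i : ℕ) : edge p i ⊆ supp y p := by
  induction p generalizing i with
  | nil => simp [edge]
  | cons a p ih =>
    cases i with
    | zero => simp [edge, supp]
    | succ i => exact (ih i).trans (by simp [supp])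

theorem edge_mem (h : IsPath E y p) {i : ℕ} (hi : i < p.length) : edge p i ∈ E := by
  induction p generalizing i with
  | nil => simp at hi
  | cons a p ih =>
    cases i with
    | zero => exact h.1
    | succ i => exact ih h.2.2.2.2.2 (by simpa using hi)

theorem head_mem_edge (h : IsPath E y p) (hp : p ≠ []) : head y p ∈ edge p 0 := by
  cases p with
  | nil => exact absurd rfl hp
  | cons a p => exact h.2.1

theorem eq_zero_of_head_mem_edge (h : IsPath E y p) {i : ℕ} (hi : head y p ∈ edge p i) :
    i = 0 := by
  cases p with
  | nil => simp [edge] at hi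
  | cons a p =>
    cases i with
    | zero => rfl
    | succ i => exact absurd (edge_subset_supp p i hi) (head_notMem_tail h)

theorem root_mem_edge (h : IsPath E y p) {i : ℕ} (hi : i + 1 = p.length) : y ∈ edge p i := by
  induction p generalizing i with
  | nil => simp at hi
  | cons a p ih =>
    cases i with
    | zero =>
      have : p = [] := by simpa using hi.symm
      subst this
      exact h.2.2.1
    | succ i => exact ih h.2.2.2.2.2 (by simpa using hi)

theorem length_of_root_mem_edge (h : IsPath E y p) {i : ℕ} (hi : y ∈ edge p i) :
    i + 1 = p.length := by
  induction p generalizing i with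
  | nil => simp [edge] at hi
  | cons a p ih =>
    cases i with
    | zero =>
      have h1 : y = head y p := h.2.2.2.2.1 y hi (root_mem_supp y p)
      by_cases hp : p = []
      · simp [hp]
      · exact absurd h1.symm (head_ne_root h.2.2.2.2.2 hp)
    | succ i =>
      have := ih h.2.2.2.2.2 hi
      simpa using this

theorem edge_inter_succ (h : IsPath E y p) {i : ℕ} (hi : i + 1 < p.length) :
    (edge p i ∩ edge p (i + 1)).card = 1 := by
  induction p generalizing i with
  | nil => simp at hi
  | cons a p ih =>
    cases i with
    | zero =>
      have hp : p ≠ [] := by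
        rintro rfl
        simp at hi
      rw [Finset.card_eq_one]
      refine ⟨head y p, ?_⟩
      ext w
      simp only [Finset.mem_inter, Finset.mem_singleton]
      constructor
      · rintro ⟨h1, h2⟩
        exact h.2.2.2.2.1 w h1 (edge_subset_supp p 0 h2)
      · rintro rfl
        exact ⟨h.2.2.1, head_mem_edge h.2.2.2.2.2 hp⟩
    | succ i => exact ih h.2.2.2.2.2 (by simpa using hi)

theorem edge_disjoint (h : IsPath E y p) {i j : ℕ} (hij : i + 1 < j) :
    Disjoint (edge p i) (edge p j) := by
  induction p generalizing i j with
  | nil => simp [edge]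
  | cons a p ih =>
    obtain ⟨j, rfl⟩ : ∃ k, j = k + 1 := ⟨j - 1, by omega⟩
    cases i with
    | zero =>
      rw [Finset.disjoint_left]
      intro w h1 h2
      have h3 := h.2.2.2.2.1 w h1 (edge_subset_supp p j h2)
      subst h3
      have := eq_zero_of_head_mem_edge h.2.2.2.2.2 h2
      omega
    | succ i => exact ih h.2.2.2.2.2 (by omega)

/-! ### Closing paths to cycles -/

/-- A path and an edge through its two ends. -/
theorem hasCycle_of_closing_edge (h : IsPath E y p) (hp : 2 ≤ p.length) {g : Finset V} (hg : g ∈ E)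
    (h1 : head y p ∈ g) (h2 : y ∈ g) (h3 : ∀ w ∈ g, w ∈ supp y p → w = head y p ∨ w = y) :
    HasCycle E (p.length + 1) := by
  have hp' : p ≠ [] := by
    rintro rfl
    simp at hp
  have key : ∀ i w, w ∈ g → w ∈ edge p i → (w = head y p ∧ i = 0) ∨ (w = y ∧ i + 1 = p.length) := by
    intro i w hw hwi
    rcases h3 w hw (edge_subset_supp p i hwi) with rfl | rfl
    · exact Or.inl ⟨rfl, eq_zero_of_head_mem_edge h hwi⟩
    · exact Or.inr ⟨rfl, length_of_root_mem_edge h hwi⟩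
  -- The list is not a path; it only numbers the edges, with `g` as number 0 and those of `p`
  -- shifted by one.
  refine ⟨edge ((y, g) :: p), ?_, ?_, ?_, ?_, ?_⟩
  · intro i hi
    cases i with
    | zero => exact hg
    | succ i => exact edge_mem h (by omega)
  · intro i hi
    cases i with
    | zero =>
      rw [Finset.card_eq_one]
      refine ⟨head y p, ?_⟩
      ext w
      simp only [Finset.mem_inter, Finset.mem_singleton]
      constructor
      · rintro ⟨h4, h5⟩
        rcases key 0 w h4 h5 with h6 | h6
        · exact h6.1
        · omega
      · rintro rfl
        exact ⟨h1, head_mem_edge h hp'⟩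
    | succ i => exact edge_inter_succ h (by omega)
  · obtain ⟨k, hk⟩ : ∃ k, p.length = k + 1 := ⟨p.length - 1, by omega⟩
    rw [Finset.card_eq_one]
    refine ⟨y, ?_⟩
    ext w
    simp only [hk, Nat.add_sub_cancel, Finset.mem_inter, Finset.mem_singleton]
    constructor
    · rintro ⟨h4, h5⟩
      rcases key k w h5 h4 with h6 | h6
      · omega
      · exact h6.1
    · rintro rfl
      exact ⟨root_mem_edge h hk.symm, h2⟩
  · intro i j hij hj hne
    obtain ⟨j, rfl⟩ : ∃ k, j = k + 1 := ⟨j - 1, by omega⟩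
    cases i with
    | zero =>
      rw [Finset.disjoint_left]
      intro w h4 h5
      rcases key j w h4 h5 with h6 | h6 <;> omega
    | succ i => exact edge_disjoint h (by omega)
  · intro i j k hij hjk hk
    obtain ⟨j, rfl⟩ : ∃ l, j = l + 1 := ⟨j - 1, by omega⟩
    obtain ⟨k, rfl⟩ : ∃ l, k = l + 1 := ⟨k - 1, by omega⟩
    ext w
    simp only [Finset.mem_inter, Finset.notMem_empty, iff_false]
    rintro ⟨⟨h4, h5⟩, h6⟩
    cases i with
    | zero =>
      rcases key j w h4 h5 with h7 | h7 <;> rcases key k w h4 h6 with h8 | h8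
      · omega
      · exact head_ne_root h hp' (h7.1.symm.trans h8.1)
      all_goals omega
    | succ i => exact Finset.disjoint_left.1 (edge_disjoint h (by omega : i + 1 < k)) h4 h6

/-- Two paths with the same ends and nothing else in common. -/
theorem hasCycle_of_two_paths (hp : IsPath E y p) (hp2 : 2 ≤ p.length) (hq : IsPath E y q)
    (hq0 : q ≠ []) (hh : head y p = head y q)
    (h : ∀ w ∈ supp y p, w ∈ supp y q → w = head y p ∨ w = y) :
    HasCycle E (p.length + q.length) := by
  induction q generalizing p with
  | nil => exact absurd rfl hq0
  | cons a q ih =>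
    obtain ⟨g1, g2, g3, g4, g5, g6⟩ := id hq
    have hpa : head y p = a.1 := hh
    have hsub : ∀ w ∈ a.2, w ∈ supp y (a :: q) := fun w hw => by
      simp only [supp, Finset.mem_union]; exact Or.inl hw
    by_cases hq1 : q = []
    · subst hq1
      exact hasCycle_of_closing_edge hp hp2 g1 (hpa ▸ g2) g3 fun w hw hwp => h w hwp (hsub w hw)
    · have hyg : y ∉ a.2 := fun hy =>
        head_ne_root g6 hq1 (g5 y hy (root_mem_supp y q)).symm
      -- The first edge of `q`, traversed backwards, is moved to the front of `p`. The total length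
      -- is unchanged, and the process stops when `q` is a single closing edge.
      have hpath : IsPath E y ((head y q, a.2) :: p) := by
        refine ⟨g1, g3, hpa ▸ g2, hpa ▸ g4.symm, fun w hw hwp => ?_, hp⟩
        rcases h w hwp (hsub w hw) with h' | rfl
        · exact h'
        · exact absurd hw hyg
      have := ih (p := (head y q, a.2) :: p) hpath (by simp; omega) g6 hq1 rfl ?_
      · simp only [List.length_cons] at this ⊢
        rwa [show p.length + (q.length + 1) = p.length + 1 + q.length by omega]
      · intro w hw hwq
        simp only [supp, Finset.mem_union] at hw
        rcases hw with hw | hw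
        · exact Or.inl (g5 w hw hwq)
        · rcases h w hw (by simp [supp, hwq]) with h' | h'
          · rw [hpa] at h'
            exact absurd (h' ▸ hwq) (head_notMem_tail hq)
          · exact Or.inr h'

/-- Two paths of equal length to the same vertex, on which common vertices have equal positions,
cut at their first common vertex. -/
theorem exists_truncation (hE : Linear E) (hp : IsPath E x p) (hq : IsPath E x q)
    (hlen : p.length = q.length) (hne : head x p ≠ head x q)
    (hlab : ∀ w ∈ supp x p, w ∈ supp x q → lab x p w = lab x q w) {w₀ : V}
    (hw₀ : w₀ ∈ supp x p) (hw₀' : w₀ ∈ supp x q)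
    (hmin : ∀ w ∈ supp x p, w ∈ supp x q → lab x p w₀ ≤ lab x p w) :
    ∃ w p' q', IsPath E w p' ∧ IsPath E w q' ∧ head w p' = head x p ∧ head w q' = head x q ∧
      p'.length = (lab x p w₀ + 1) / 2 ∧ q'.length = (lab x p w₀ + 1) / 2 ∧
      supp w p' ⊆ supp x p ∧ supp w q' ⊆ supp x q ∧ p' ≠ [] ∧ q' ≠ [] ∧
      ∀ t ∈ supp w p', t ∈ supp w q' → t = w := by
  induction p generalizing q with
  | nil =>
    cases q with
    | nil => exact absurd rfl hne
    | cons b q => simp at hlen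
  | cons a p ih =>
    cases q with
    | nil => simp at hlen
    | cons b q =>
      obtain ⟨p1, p2, p3, p4, p5, p6⟩ := id hp
      obtain ⟨q1, q2, q3, q4, q5, q6⟩ := id hq
      have hab : a.1 ≠ b.1 := hne
      have ha : a.2 ⊆ supp x (a :: p) := by simp [supp]
      have hb : b.2 ⊆ supp x (b :: q) := by simp [supp]
      have hp' : supp x p ⊆ supp x (a :: p) := by simp [supp]
      have hq' : supp x q ⊆ supp x (b :: q) := by simp [supp]
      have hzero : ∀ w ∈ supp x (a :: p), w ∈ supp x (b :: q) → lab x (a :: p) w ≠ 0 := by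
        intro w hw hw' h0
        have h1 : w = a.1 := eq_head_of_lab hw h0
        have h2 : w = b.1 := eq_head_of_lab hw' ((hlab w hw hw') ▸ h0)
        exact hab (h1.symm.trans h2)
      by_cases hdis : ∃ w, w ∈ a.2 ∧ w ∈ b.2
      · obtain ⟨w, hwa, hwb⟩ := hdis
        -- If the first edges meet, both paths are cut after one edge: a vertex of the first edge
        -- has position at most 2, and position 0 is excluded since the first vertices differ.
        have hle : lab x (a :: p) w ≤ 2 := by
          by_cases hwp : w ∈ supp x p
          · rw [lab_cons_of_mem hp hwp, p5 w hwa hwp, lab_head]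
          · simp only [lab, hwp, if_false]
            split_ifs <;> omega
        have h1 := hmin w (ha hwa) (hb hwb)
        have h2 := hzero w₀ hw₀ hw₀'
        have h3 : (lab x (a :: p) w₀ + 1) / 2 = 1 := by omega
        have hwa' : a.1 ≠ w := by
          rintro rfl
          exact hzero _ (ha hwa) (hb hwb) (lab_head (p := a :: p))
        have hwb' : b.1 ≠ w := by
          rintro rfl
          refine hzero _ (ha hwa) (hb hwb) ?_
          rw [hlab _ (ha hwa) (hb hwb)]
          exact lab_head (p := b :: q)
        refine ⟨w, [a], [b], ⟨p1, p2, hwa, hwa', ?_, trivial⟩, ⟨q1, q2, hwb, hwb', ?_, trivial⟩,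
          rfl, rfl, by simp [h3], by simp [h3], ?_, ?_, by simp, by simp, ?_⟩
        · intro t _ ht
          simpa [supp, head] using ht
        · intro t _ ht
          simpa [supp, head] using ht
        · simp only [supp]
          intro t ht
          simp only [Finset.mem_union, Finset.mem_singleton] at ht ⊢
          rcases ht with ht | rfl <;> simp [*]
        · simp only [supp]
          intro t ht
          simp only [Finset.mem_union, Finset.mem_singleton] at ht ⊢
          rcases ht with ht | rfl <;> simp [*]
        · intro t ht ht'
          simp only [supp, Finset.mem_union, Finset.mem_singleton] at ht ht'
          by_contra htw
          simp only [htw, or_false] at ht ht'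
          -- A second common vertex would make the edges equal, and then `a.1` would be a common
          -- vertex at position 0.
          have heq : a.2 = b.2 := hE _ p1 _ q1 t w htw ht hwa ht' hwb
          exact hzero a.1 (ha p2) (hb (heq ▸ p2)) (lab_head (p := a :: p))
      · push Not at hdis
        have hlabP : ∀ w ∈ supp x p, w ∈ supp x q → lab x p w = lab x q w := by
          intro w hw hw'
          have := hlab w (hp' hw) (hq' hw')
          rw [lab_cons_of_mem hp hw, lab_cons_of_mem hq hw'] at this
          omega
        have hne' : head x p ≠ head x q := by
          intro h
          exact hdis _ p3 (h ▸ q3)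
        -- On the tail of the second path `t` has position at least 2. Equal positions force `t` to
        -- be the first vertex of both tails, but these vertices differ.
        have hcross1 : ∀ t ∈ a.2, t ∉ supp x q := by
          intro t ht htq
          have h1 := hlab t (ha ht) (hq' htq)
          rw [lab_cons_of_mem hq htq] at h1
          have htp : t ∈ supp x p := by
            by_contra htp
            simp only [lab, htp, if_false] at h1
            split_ifs at h1
            omega
          have h2 := p5 t ht htp
          rw [lab_cons_of_mem hp htp, h2, lab_head] at h1
          have h3 : lab x q t = 0 := by rw [h2]; omega
          exact hne' (h2.symm.trans (eq_head_of_lab htq h3))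
        have hcross2 : ∀ t ∈ b.2, t ∉ supp x p := by
          intro t ht htp
          have h1 := hlab t (hp' htp) (hb ht)
          rw [lab_cons_of_mem hp htp] at h1
          have htq : t ∈ supp x q := by
            by_contra htq
            simp only [lab, htq, if_false] at h1
            split_ifs at h1
            omega
          have h2 := q5 t ht htq
          rw [lab_cons_of_mem hq htq, h2, lab_head] at h1
          have h3 : lab x p t = 0 := by rw [h2]; omega
          exact hne' ((eq_head_of_lab htp h3).symm.trans h2)
        have hcommon : ∀ t ∈ supp x (a :: p), t ∈ supp x (b :: q) →
            t ∈ supp x p ∧ t ∈ supp x q := by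
          intro t ht ht'
          simp only [supp, Finset.mem_union] at ht ht'
          rcases ht with ht | ht <;> rcases ht' with ht' | ht'
          · exact absurd ht' (hdis t ht)
          · exact absurd ht' (hcross1 t ht)
          · exact absurd ht (hcross2 t ht')
          · exact ⟨ht, ht'⟩
        obtain ⟨c1, c2⟩ := hcommon w₀ hw₀ hw₀'
        have e1 := lab_cons_of_mem hp c1
        obtain ⟨w, p', q', r1, r2, r3, r4, r5, r6, r7, r8, r9, r10, r11⟩ :=
          ih p6 q6 (by simpa using hlen) hne' hlabP c1 c2 (by
            intro w hw hw'
            have := hmin w (hp' hw) (hq' hw')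
            rw [e1, lab_cons_of_mem hp hw] at this
            omega)
        refine ⟨w, a :: p', b :: q', ⟨p1, p2, r3.symm ▸ p3, r3.symm ▸ p4, ?_, r1⟩,
          ⟨q1, q2, r4.symm ▸ q3, r4.symm ▸ q4, ?_, r2⟩, rfl, rfl, ?_, ?_, ?_, ?_, by simp, by simp, ?_⟩
        · intro t ht ht'
          rw [r3]
          exact p5 t ht (r7 ht')
        · intro t ht ht'
          rw [r4]
          exact q5 t ht (r8 ht')
        · rw [e1, List.length_cons, r5]; omega
        · rw [e1, List.length_cons, r6]; omega
        · exact Finset.union_subset_union_right r7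
        · exact Finset.union_subset_union_right r8
        · intro t ht ht'
          simp only [supp, Finset.mem_union] at ht ht'
          rcases ht with ht | ht <;> rcases ht' with ht' | ht'
          · exact absurd ht' (hdis t ht)
          · exact absurd (r8 ht') (hcross1 t ht)
          · exact absurd (r7 ht) (hcross2 t ht')
          · exact r11 t ht ht'

end LinearPath

/-! ### Cores and spread subfamilies -/

namespace LinearPath

section Counting

variable {ι β γ Ω : Type*} [DecidableEq β] [DecidableEq γ] [DecidableEq Ω]

/-- A dense incidence system has a nonempty subsystem of large minimum degree. -/
theorem exists_core (inc : ι → Finset γ) (D : ℕ) (F : Finset ι)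
    (h : D * (F.biUnion inc).card < F.card) :
    ∃ F' ⊆ F, F'.Nonempty ∧ ∀ v ∈ F'.biUnion inc, D < (F'.filter fun f => v ∈ inc f).card := by
  induction F using Finset.strongInduction with
  | H F ih =>
    by_cases hF : ∀ v ∈ F.biUnion inc, D < (F.filter fun f => v ∈ inc f).card
    · exact ⟨F, subset_rfl, Finset.card_pos.1 (by omega), hF⟩
    · push Not at hF
      obtain ⟨v, hv, hvD⟩ := hF
      obtain ⟨f, hf, hvf⟩ := Finset.mem_biUnion.1 hv
      -- Deleting a vertex of degree at most `D` loses at most `D` members and at least one vertex,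
      -- so the density hypothesis survives.
      have hss : (F.filter fun f => v ∉ inc f) ⊂ F := by
        refine (Finset.filter_subset _ _).ssubset_of_ne fun h => ?_
        have := h ▸ hf
        simp [hvf] at this
      have hU : ((F.filter fun f => v ∉ inc f).biUnion inc) ⊆ (F.biUnion inc).erase v := by
        intro w hw
        obtain ⟨g, hg, hwg⟩ := Finset.mem_biUnion.1 hw
        rw [Finset.mem_filter] at hg
        rw [Finset.mem_erase, Finset.mem_biUnion]
        exact ⟨fun h => hg.2 (h ▸ hwg), g, hg.1, hwg⟩
      have hU' := Finset.card_le_card hU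
      rw [Finset.card_erase_of_mem hv] at hU'
      have hpos : 0 < (F.biUnion inc).card := Finset.card_pos.2 ⟨v, hv⟩
      have hsum := Finset.card_filter_add_card_filter_not (s := F) (fun f => v ∈ inc f)
      have hmul : D * ((F.filter fun f => v ∉ inc f).biUnion inc).card + D
          ≤ D * (F.biUnion inc).card := by
        rw [← Nat.mul_succ]
        exact Nat.mul_le_mul_left _ (by omega)
      obtain ⟨F', h1, h2, h3⟩ := ih _ hss (by omega)
      exact ⟨F', h1.trans hss.subset, h2, h3⟩

/-- Every finite family of sets of bounded size has a large subfamily of sets containing a common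
set `τ` such that each further element lies in few of its members. -/
theorem exists_spread (g : ι → Finset Ω) {R B : ℕ} (hB : 1 ≤ B) (N : Finset ι)
    (hg : ∀ f ∈ N, (g f).card ≤ R) :
    ∃ τ : Finset Ω, N.card ≤ B ^ R * (N.filter fun f => τ ⊆ g f).card ∧
      ∀ v ∉ τ, B * ((N.filter fun f => τ ⊆ g f).filter fun f => v ∈ g f).card ≤
        (N.filter fun f => τ ⊆ g f).card := by
  rcases N.eq_empty_or_nonempty with rfl | hN
  · exact ⟨∅, by simp⟩
  by_contra! hcon
  -- If no `τ` is suitable, some element outside `τ` lies in more than a `1 / B` fraction of the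
  -- remaining members and can be added to `τ`. With `R + 1` elements `τ` would exceed the size of
  -- every member.
  have key : ∀ k, ∃ τ : Finset Ω, τ.card = k ∧
      N.card ≤ B ^ k * (N.filter fun f => τ ⊆ g f).card := by
    intro k
    induction k with
    | zero => exact ⟨∅, by simp⟩
    | succ k ih =>
      obtain ⟨τ, hτ, hle⟩ := ih
      have hne : (N.filter fun f => τ ⊆ g f).Nonempty := by
        rw [← Finset.card_pos]
        by_contra h0
        have h1 := hN.card_pos
        simp only [not_lt, Nat.le_zero] at h0
        rw [h0] at hle
        omega
      obtain ⟨f, hf⟩ := hne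
      rw [Finset.mem_filter] at hf
      have hkR : k ≤ R := hτ ▸ (Finset.card_le_card hf.2).trans (hg f hf.1)
      obtain ⟨v, hv, hlt⟩ := hcon τ (hle.trans
        (Nat.mul_le_mul_right _ (Nat.pow_le_pow_right hB hkR)))
      refine ⟨insert v τ, by rw [Finset.card_insert_of_notMem hv, hτ], hle.trans ?_⟩
      have : (N.filter fun f => insert v τ ⊆ g f) =
          (N.filter fun f => τ ⊆ g f).filter fun f => v ∈ g f := by
        ext f
        simp only [Finset.mem_filter, Finset.insert_subset_iff]
        tauto
      rw [this, pow_succ, mul_assoc]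
      exact Nat.mul_le_mul_left _ hlt.le
  obtain ⟨τ, hτ, hle⟩ := key (R + 1)
  have h0 : (N.filter fun f => τ ⊆ g f) = ∅ := by
    rw [Finset.filter_eq_empty_iff]
    intro f hf hsub
    have := (Finset.card_le_card hsub).trans (hg f hf)
    omega
  rw [h0] at hle
  rw [Finset.card_empty, mul_zero] at hle
  have := hN.card_pos
  omega

/-- `exists_spread` in every fibre of `key`. -/
theorem exists_spread_fibres (key : ι → β) (g : ι → Finset Ω) {R B : ℕ} (hB : 1 ≤ B)
    (F : Finset ι) (hg : ∀ f ∈ F, (g f).card ≤ R) :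
    ∃ (τ : β → Finset Ω) (F' : Finset ι), F' ⊆ F ∧ (∀ f ∈ F', τ (key f) ⊆ g f) ∧
      F.card ≤ B ^ R * F'.card ∧
      ∀ b, ∀ v ∉ τ b, B * ((F'.filter fun f => key f = b).filter fun f => v ∈ g f).card ≤
        (F'.filter fun f => key f = b).card := by
  have h := fun b => exists_spread g hB (F.filter fun f => key f = b)
    (fun f hf => hg f (Finset.mem_filter.1 hf).1)
  choose τ h1 h2 using h
  have hfib : ∀ b, ((F.filter fun f => τ (key f) ⊆ g f).filter fun f => key f = b) =
      (F.filter fun f => key f = b).filter fun f => τ b ⊆ g f := by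
    intro b
    ext f
    simp only [Finset.mem_filter]
    constructor
    · rintro ⟨⟨h3, h4⟩, rfl⟩
      exact ⟨⟨h3, rfl⟩, h4⟩
    · rintro ⟨⟨h3, rfl⟩, h4⟩
      exact ⟨⟨h3, h4⟩, rfl⟩
  refine ⟨τ, F.filter fun f => τ (key f) ⊆ g f, Finset.filter_subset _ _,
    fun f hf => (Finset.mem_filter.1 hf).2, ?_, ?_⟩
  · rw [Finset.card_eq_sum_card_fiberwise (f := key) (t := F.image key)
        (fun f hf => Finset.mem_image_of_mem key hf),
      Finset.card_eq_sum_card_fiberwise (s := F.filter fun f => τ (key f) ⊆ g f) (f := key)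
        (t := F.image key) (fun f hf => Finset.mem_image_of_mem key (Finset.mem_filter.1 hf).1),
      Finset.mul_sum]
    refine Finset.sum_le_sum fun b _ => ?_
    rw [hfib]
    exact h1 b
  · intro b v hv
    rw [hfib]
    exact h2 b v hv

/-- Discarding the members in fibres of size at most `D`. -/
theorem card_le_card_filter_add (key : ι → β) (F : Finset ι) (T : Finset β)
    (hT : ∀ f ∈ F, key f ∈ T) (D : ℕ) :
    F.card ≤ (F.filter fun f => D < (F.filter fun g => key g = key f).card).card + D * T.card := by
  rw [← Finset.card_filter_add_card_filter_not (s := F)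
    (fun f => D < (F.filter fun g => key g = key f).card)]
  refine Nat.add_le_add_left ?_ _
  refine Finset.card_le_mul_card_image_of_maps_to (f := key)
    (s := F.filter fun f => ¬ D < (F.filter fun g => key g = key f).card) (fun f hf => hT f (Finset.mem_filter.1 hf).1) D ?_
  intro b _
  by_contra hlt
  rw [not_le] at hlt
  obtain ⟨f, hf⟩ := Finset.card_pos.1 (pos_of_gt hlt : 0 <
    ((F.filter fun f => ¬ D < (F.filter fun g => key g = key f).card).filter
      fun f => key f = b).card)
  rw [Finset.mem_filter, Finset.mem_filter] at hf
  obtain ⟨⟨_, h1⟩, rfl⟩ := hf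
  have hsub : (F.filter fun f => ¬ D < (F.filter fun g => key g = key f).card).filter
      (fun g => key g = key f) ⊆ F.filter fun g => key g = key f := by
    intro g hg
    simp only [Finset.mem_filter] at hg ⊢
    exact ⟨hg.1.1, hg.2⟩
  exact h1 (hlt.trans_le (Finset.card_le_card hsub))

end Counting

/-! ### Avoiding small sets -/

section Avoid

variable {V : Type*} [DecidableEq V] {E N : Finset (Finset V)}

/-- By linearity an edge through `c` is determined by any other of its vertices, so each vertex of
`X` spoils at most one edge. -/
theorem card_hitting_le (hE : Linear E) (hN : N ⊆ E) (c : V) (hc : ∀ f ∈ N, c ∈ f)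
    (X : Finset V) : (N.filter fun f => ∃ t ∈ f, t ∈ X ∧ t ≠ c).card ≤ X.card := by
  have : (N.filter fun f => ∃ t ∈ f, t ∈ X ∧ t ≠ c) ⊆
      (X.filter fun t => t ≠ c).biUnion fun t => N.filter fun f => t ∈ f := by
    intro f hf
    simp only [Finset.mem_filter, Finset.mem_biUnion] at hf ⊢
    obtain ⟨h1, t, h2, h3, h4⟩ := hf
    exact ⟨t, ⟨h3, h4⟩, h1, h2⟩
  refine (Finset.card_le_card this).trans (Finset.card_biUnion_le.trans ?_)
  calc _ ≤ ∑ t ∈ X.filter (fun t => t ≠ c), 1 := by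
        refine Finset.sum_le_sum fun t ht => ?_
        rw [Finset.card_le_one]
        intro f hf g hg
        simp only [Finset.mem_filter] at hf hg ht
        exact hE f (hN hf.1) g (hN hg.1) t c ht.2 hf.2 (hc f hf.1) hg.2 (hc g hg.1)
    _ ≤ X.card := by
        rw [Finset.sum_const, smul_eq_mul, mul_one]
        exact Finset.card_filter_le _ _

/-- Among many edges through `c`, one avoids a given small set otherwise. -/
theorem exists_avoiding (hE : Linear E) (hN : N ⊆ E) (c : V) (hc : ∀ f ∈ N, c ∈ f)
    (X : Finset V) (hX : X.card < N.card) : ∃ f ∈ N, ∀ t ∈ f, t ∈ X → t = c := by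
  by_contra! hcon
  have := card_hitting_le hE hN c hc X
  rw [Finset.filter_true_of_mem hcon] at this
  omega

/-- Among many edges through `c`, one avoids a given small set otherwise, and the set attached
to it meets a given small set only in `τ`. -/
theorem exists_avoiding_spread {Ω : Type*} [DecidableEq Ω] (hE : Linear E) (hN : N ⊆ E) (c : V)
    (hc : ∀ f ∈ N, c ∈ f) (X : Finset V) (hX : 2 * X.card < N.card) (g : Finset V → Finset Ω)
    (τ Y : Finset Ω) {B : ℕ} (hB : 1 ≤ B) (hY : 2 * Y.card ≤ B)
    (hg : ∀ v ∉ τ, B * (N.filter fun f => v ∈ g f).card ≤ N.card) :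
    ∃ f ∈ N, (∀ t ∈ f, t ∈ X → t = c) ∧ ∀ v ∈ g f, v ∈ Y → v ∈ τ := by
  by_contra! hcon
  have h1 := card_hitting_le hE hN c hc X
  -- Each element of `Y \ τ` spoils at most a `1 / B` fraction of `N`, hence all of them at most
  -- half; `X` spoils strictly less than half.
  have h2 : B * ((Y \ τ).biUnion fun v => N.filter fun f => v ∈ g f).card ≤ Y.card * N.card := by
    calc _ ≤ B * ∑ v ∈ Y \ τ, (N.filter fun f => v ∈ g f).card :=
          Nat.mul_le_mul_left _ Finset.card_biUnion_le
      _ = ∑ v ∈ Y \ τ, B * (N.filter fun f => v ∈ g f).card := Finset.mul_sum _ _ _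
      _ ≤ ∑ v ∈ Y \ τ, N.card :=
          Finset.sum_le_sum fun v hv => hg v (Finset.mem_sdiff.1 hv).2
      _ ≤ Y.card * N.card := by
          rw [Finset.sum_const, smul_eq_mul]
          exact Nat.mul_le_mul_right _ (Finset.card_le_card Finset.sdiff_subset)
  have h3 : N ⊆ (N.filter fun f => ∃ t ∈ f, t ∈ X ∧ t ≠ c) ∪
      ((Y \ τ).biUnion fun v => N.filter fun f => v ∈ g f) := by
    intro f hf
    simp only [Finset.mem_union, Finset.mem_filter, Finset.mem_biUnion, Finset.mem_sdiff]
    by_cases h : ∃ t ∈ f, t ∈ X ∧ t ≠ c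
    · exact Or.inl ⟨hf, h⟩
    · push Not at h
      obtain ⟨v, h4, h5, h6⟩ := hcon f hf h
      exact Or.inr ⟨v, ⟨h5, h6⟩, hf, h4⟩
  have h4 := (Finset.card_le_card h3).trans (Finset.card_union_le _ _)
  have h5 : 2 * ((Y \ τ).biUnion fun v => N.filter fun f => v ∈ g f).card ≤ N.card := by
    refine Nat.le_of_mul_le_mul_left (c := B) ?_ hB
    calc _ = 2 * (B * ((Y \ τ).biUnion fun v => N.filter fun f => v ∈ g f).card) := by ring
      _ ≤ 2 * (Y.card * N.card) := Nat.mul_le_mul_left _ h2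
      _ = (2 * Y.card) * N.card := by ring
      _ ≤ B * N.card := Nat.mul_le_mul_right _ hY
  omega

end Avoid

end LinearPath

/-! ### Marked paths and cycles through meeting paths -/

namespace LinearPath

variable {V : Type*} [DecidableEq V] {E F N : Finset (Finset V)} {x : V}

/-- The vertices of a path, each with its position. -/
def marks (x : V) (p : List (V × Finset V)) : Finset (V × ℕ) :=
  (supp x p).image fun w => (w, lab x p w)

theorem mem_marks {p : List (V × Finset V)} {w : V} {i : ℕ} :
    (w, i) ∈ marks x p ↔ w ∈ supp x p ∧ lab x p w = i := by
  simp only [marks, Finset.mem_image, Prod.mk.injEq]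
  constructor
  · rintro ⟨v, h1, rfl, h2⟩
    exact ⟨h1, h2⟩
  · rintro ⟨h1, h2⟩
    exact ⟨w, h1, rfl, h2⟩

/-- The number of edges after which two paths with common marks `τ` meet. -/
noncomputable def meetLength (τ : Finset (V × ℕ)) : ℕ := (sInf {i | ∃ t, (t, i) ∈ τ} + 1) / 2

theorem meetLength_le {τ : Finset (V × ℕ)} {p : List (V × Finset V)} (h : τ ⊆ marks x p) :
    meetLength τ ≤ p.length := by
  have : sInf {i | ∃ t, (t, i) ∈ τ} ≤ 2 * p.length := by
    by_cases hS : {i | ∃ t, (t, i) ∈ τ}.Nonempty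
    · obtain ⟨t, ht⟩ := Nat.sInf_mem hS
      rw [← (mem_marks.1 (h ht)).2]
      exact lab_le _ _ _
    · rw [Set.not_nonempty_iff_eq_empty.1 hS]
      simp
  unfold meetLength
  omega

/-- A path between the first vertices of two paths of equal length to `x` closes a cycle. -/
theorem hasCycle_of_meeting_paths (hE : Linear E) {p q W : List (V × Finset V)}
    (hp : IsPath E x p) (hq : IsPath E x q) (hlen : p.length = q.length)
    (hW : IsPath E (head x p) W) (hW0 : W ≠ []) (hWq : head (head x p) W = head x q)
    (hWp' : ∀ t ∈ supp (head x p) W, t ∈ supp x p → t = head x p)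
    (hWq' : ∀ t ∈ supp (head x p) W, t ∈ supp x q → t = head x q)
    (hlab : ∀ w ∈ supp x p, w ∈ supp x q → lab x p w = lab x q w) :
    HasCycle E (W.length + 2 * meetLength (marks x p ∩ marks x q)) := by
  have hne : head x p ≠ head x q := fun h => head_ne_root hW hW0 (hWq.trans h.symm)
  set S : Set ℕ := {i | ∃ t, (t, i) ∈ marks x p ∩ marks x q} with hS
  have hmem : ∀ w ∈ supp x p, w ∈ supp x q → lab x p w ∈ S := fun w h1 h2 =>
    ⟨w, Finset.mem_inter.2 ⟨mem_marks.2 ⟨h1, rfl⟩, mem_marks.2 ⟨h2, (hlab w h1 h2).symm⟩⟩⟩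
  obtain ⟨w₀, hw₀⟩ := Nat.sInf_mem ⟨_, hmem x (root_mem_supp x p) (root_mem_supp x q)⟩
  rw [Finset.mem_inter, mem_marks, mem_marks] at hw₀
  obtain ⟨⟨h1, h2⟩, h3, -⟩ := hw₀
  obtain ⟨w, p', q', r1, r2, r3, r4, r5, r6, r7, r8, r9, r10, r11⟩ :=
    exists_truncation hE hp hq hlen hne hlab h1 h3 fun t ht ht' => h2 ▸ Nat.sInf_le (hmem t ht ht')
  rw [h2] at r5 r6
  change p'.length = meetLength (marks x p ∩ marks x q) at r5
  change q'.length = meetLength (marks x p ∩ marks x q) at r6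
  have hu : head x p ∈ supp w p' := r3 ▸ head_mem_supp r1
  -- The cycle consists of `W` continued by the truncated first path, and of the truncated second
  -- path.
  have hpath : IsPath E w (W ++ p') := hW.append r1 r3 fun t ht ht' => hWp' t ht (r7 ht')
  have hh : head w (W ++ p') = head x q := by rw [head_append r3, hWq]
  have := hasCycle_of_two_paths hpath ?_ r2 r10 (hh.trans r4.symm) ?_
  · rw [List.length_append, r5, r6] at this
    rwa [two_mul, ← add_assoc]
  · have := List.length_pos_iff.2 hW0
    have := List.length_pos_iff.2 r9
    rw [List.length_append]
    omega
  · intro t ht ht'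
    rw [supp_append hu, Finset.mem_union] at ht
    rw [hh]
    rcases ht with ht | ht
    · exact Or.inl (hWq' t ht (r8 ht'))
    · exact Or.inr (r11 t ht ht')

/-- A linear path of length `i` from each vertex of `A` to `x`. -/
def IsPathSystem (E : Finset (Finset V)) (x : V) (i : ℕ) (A : Finset V)
    (P : V → List (V × Finset V)) : Prop :=
  ∀ u ∈ A, IsPath E x (P u) ∧ head x (P u) = u ∧ (P u).length = i

variable {r m i B : ℕ} {A : Finset V} {P : V → List (V × Finset V)}

theorem IsPathSystem.supp_card_le (hr : ∀ e ∈ E, e.card = r) (hP : IsPathSystem E x i A P)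
    (him : i ≤ m) {u : V} (hu : u ∈ A) : (supp x (P u)).card ≤ r * m + 1 := by
  obtain ⟨h1, -, h3⟩ := hP u hu
  refine (LinearPath.supp_card_le hr h1).trans ?_
  rw [h3]
  gcongr

/-- The last edge of a path outside the path system, chosen among many candidates. -/
theorem hasCycle_of_spread (hE : Linear E) (hr : ∀ e ∈ E, e.card = r)
    (hP : IsPathSystem E x i A P) (him : i ≤ m) (hB : 2 * ((3 * r * m + 2) * (2 * m + 1)) ≤ B)
    {u : V} (hu : u ∈ A) {W : List (V × Finset V)} (hW : IsPath E u W) (hWm : W.length ≤ 2 * m)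
    (hWu : ∀ t ∈ supp u W, t ∈ supp x (P u) → t = u) (a : Finset V → V) (hN : N ⊆ E)
    (hNW : ∀ f ∈ N, head u W ∈ f) (ha : ∀ f ∈ N, a f ∈ f) (haA : ∀ f ∈ N, a f ∈ A)
    (haW : ∀ f ∈ N, a f ≠ head u W) (hNa : ∀ f ∈ N, ∀ t ∈ f, t ∈ supp x (P (a f)) → t = a f)
    (hNc : 2 * (3 * r * m + 2) < N.card) {τ : Finset (V × ℕ)}
    (hτ : ∀ f ∈ N, τ ⊆ marks x (P (a f)))
    (hspread : ∀ v ∉ τ, B * (N.filter fun f => v ∈ marks x (P (a f))).card ≤ N.card)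
    (hτu : ∀ t j, (t, j) ∈ τ → j ≠ 0 → t ∈ supp u W ∪ supp x (P u) → (t, j) ∈ marks x (P u)) :
    HasCycle E (W.length + 1 + 2 * meetLength (τ ∩ marks x (P u))) := by
  obtain ⟨p1, p2, p3⟩ := hP u hu
  set X := supp u W ∪ supp x (P u)
  have hXc : X.card ≤ 3 * r * m + 2 := by
    refine (Finset.card_union_le _ _).trans ?_
    have h1 := LinearPath.supp_card_le hr hW
    have h2 := hP.supp_card_le hr him hu
    have h3 : r * W.length ≤ r * (2 * m) := Nat.mul_le_mul_left _ hWm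
    have h4 : 3 * r * m = r * (2 * m) + r * m := by ring
    omega
  have hB1 : 1 ≤ B := by
    have : 1 ≤ 2 * ((3 * r * m + 2) * (2 * m + 1)) := Nat.succ_le_of_lt (by positivity)
    omega
  -- The marks to avoid are the vertices of `X` in every possible position; positions are at most `2
  -- * i`, hence at most `2 * m`.
  obtain ⟨f, hf, hfX, hfτ⟩ := exists_avoiding_spread hE hN (head u W) hNW X (by omega)
    (fun f => marks x (P (a f))) τ (X ×ˢ Finset.range (2 * m + 1)) hB1 (by
      rw [Finset.card_product, Finset.card_range]
      exact (Nat.mul_le_mul_left _ (Nat.mul_le_mul_right _ hXc)).trans hB) hspread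
  obtain ⟨q1, q2, q3⟩ := hP (a f) (haA f hf)
  have hinτ : ∀ t ∈ X, t ∈ supp x (P (a f)) → (t, lab x (P (a f)) t) ∈ τ := by
    intro t ht ht'
    refine hfτ _ (mem_marks.2 ⟨ht', rfl⟩) (Finset.mem_product.2 ⟨ht, Finset.mem_range.2 ?_⟩)
    have := lab_le x (P (a f)) t
    dsimp only
    omega
  have haX : a f ∉ X := fun h => haW f hf (hfX _ (ha f hf) h)
  have hlab0 : ∀ t ∈ X, t ∈ supp x (P (a f)) → lab x (P (a f)) t ≠ 0 := by
    intro t ht ht' h0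
    have := eq_head_of_lab ht' h0
    rw [q2] at this
    exact haX (this ▸ ht)
  -- Every meeting of the new path with `X` is thus a vertex of `P u` in the same position. Position
  -- 0 cannot occur, so the hypothesis on `τ` may ignore it; the odd case needs this freedom.
  have hinu : ∀ t ∈ X, t ∈ supp x (P (a f)) → t ∈ supp x (P u) ∧
      lab x (P u) t = lab x (P (a f)) t := fun t ht ht' =>
    mem_marks.1 (hτu t _ (hinτ t ht ht') (hlab0 t ht ht') ht)
  have hinter : τ ∩ marks x (P u) = marks x (P u) ∩ marks x (P (a f)) := by
    ext ⟨t, j⟩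
    simp only [Finset.mem_inter]
    constructor
    · rintro ⟨h1, h2⟩
      exact ⟨h2, hτ f hf h1⟩
    · rintro ⟨h1, h2⟩
      refine ⟨?_, h1⟩
      have h3 := mem_marks.1 h2
      rw [← h3.2]
      exact hinτ t (Finset.mem_union_right _ (mem_marks.1 h1).1) h3.1
  have hWX : ∀ t ∈ supp u W, t ∈ X := fun t ht => Finset.mem_union_left _ ht
  have hheadW : head u W ∈ supp u W := head_mem_supp hW
  have hW' : IsPath E u ((a f, f) :: W) :=
    ⟨hN hf, ha f hf, hNW f hf, haW f hf, fun t ht ht' => hfX t ht (hWX t ht'), hW⟩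
  have := hasCycle_of_meeting_paths hE p1 q1 (p3.trans q3.symm) (W := (a f, f) :: W)
    (by rwa [p2]) (by simp) (by rw [q2]; rfl) ?_ ?_ ?_
  · rw [hinter]
    exact this
  · rw [p2]
    intro t ht ht'
    simp only [supp, Finset.mem_union] at ht
    rcases ht with ht | ht
    · have := hfX t ht (Finset.mem_union_right _ ht')
      subst this
      exact hWu _ hheadW ht'
    · exact hWu t ht ht'
  · rw [p2, q2]
    intro t ht ht'
    simp only [supp, Finset.mem_union] at ht
    rcases ht with ht | ht
    · exact hNa f hf t ht ht'
    · obtain ⟨h1, h2⟩ := hinu t (hWX t ht) ht'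
      have h3 := hWu t ht h1
      exfalso
      refine hlab0 t (hWX t ht) ht' ?_
      rw [← h2]
      exact lab_eq_zero (h3.trans p2.symm)
  · intro t ht ht'
    exact (hinu t (Finset.mem_union_right _ ht) ht').2

/-- A greedy path of odd length in a system of edges in which the fibres of `a` (within a class of
`κ`) and of `b` are large. -/
theorem exists_path_in_core (hE : Linear E) (hr : ∀ e ∈ E, e.card = r) {Ω : Type*}
    [DecidableEq Ω] (hF : F ⊆ E) (a b : Finset V → V) (κ : V → Ω) (ha : ∀ f ∈ F, a f ∈ f)
    (hb : ∀ f ∈ F, b f ∈ f) (hab : ∀ f ∈ F, a f ≠ b f) {D : ℕ}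
    (hDa : ∀ f ∈ F, D < (F.filter fun g => a g = a f ∧ κ (b g) = κ (b f)).card)
    (hDb : ∀ f ∈ F, D < (F.filter fun g => b g = b f).card) {f₀ : Finset V} (hf₀ : f₀ ∈ F)
    (S : Finset V) (k : ℕ) (hD : S.card + (r * (2 * k) + 1) ≤ D) :
    ∃ W, IsPath E (a f₀) W ∧ W.length = 2 * k + 1 ∧
      (∀ t ∈ supp (a f₀) W, t ∈ S → t = a f₀) ∧
      ∃ f ∈ F, b f = head (a f₀) W ∧ κ (b f) = κ (b f₀) := by
  -- An edge from an `a`-vertex to a `b`-vertex, taken from a fibre on which `κ` of the `b`-vertex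
  -- is constant. The way back goes through a fibre of `b`, so `κ` stays constant along the whole
  -- path.
  have step : ∀ (u : V) (W : List (V × Finset V)) (g : Finset V), g ∈ F → a g = head u W →
      IsPath E u W → (∀ t ∈ supp u W, t ∈ S → t = u) → S.card + (supp u W).card ≤ D →
      ∃ f ∈ F, κ (b f) = κ (b g) ∧ IsPath E u ((b f, f) :: W) ∧
        ∀ t ∈ supp u ((b f, f) :: W), t ∈ S → t = u := by
    intro u W g hg hgW hW hWS hc
    obtain ⟨f, hf, hfX⟩ := exists_avoiding (N := F.filter fun f => a f = a g ∧ κ (b f) = κ (b g))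
      hE ((Finset.filter_subset _ _).trans hF) (a g)
      (fun f hf => by
        rw [Finset.mem_filter] at hf
        exact hf.2.1 ▸ ha f hf.1) (S ∪ supp u W)
      (((Finset.card_union_le _ _).trans hc).trans_lt (hDa g hg))
    rw [Finset.mem_filter] at hf
    obtain ⟨hf, hfa, hfκ⟩ := hf
    refine ⟨f, hf, hfκ, ⟨hF hf, hb f hf, hgW ▸ hfa ▸ ha f hf, ?_, fun t ht ht' => ?_, hW⟩, ?_⟩
    · rw [← hgW, ← hfa]
      exact (hab f hf).symm
    · rw [← hgW]
      exact hfX t ht (Finset.mem_union_right _ ht')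
    · intro t ht htS
      simp only [supp, Finset.mem_union] at ht
      rcases ht with ht | ht
      · have h := hfX t ht (Finset.mem_union_left _ htS)
        exact hWS t (h ▸ hgW ▸ head_mem_supp hW) htS
      · exact hWS t ht htS
  induction k with
  | zero =>
    obtain ⟨f, h1, h2, h3, h4⟩ := step (a f₀) [] f₀ hf₀ rfl trivial
      (fun t ht _ => by simpa [supp] using ht) (by simp only [supp, Finset.card_singleton]; omega)
    exact ⟨[(b f, f)], h3, rfl, h4, f, h1, rfl, h2⟩
  | succ k ih =>
    rw [show r * (2 * (k + 1)) = r * (2 * k) + r + r by ring] at hD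
    obtain ⟨W, h1, h2, h3, f, h4, h5, h6⟩ := ih (by omega)
    have hc := LinearPath.supp_card_le hr h1
    rw [h2, mul_add, mul_one] at hc
    obtain ⟨g, hg, hgX⟩ := exists_avoiding (N := F.filter fun g => b g = b f)
      hE ((Finset.filter_subset _ _).trans hF) (b f)
      (fun f hf => by
        rw [Finset.mem_filter] at hf
        exact hf.2 ▸ hb _ hf.1) (S ∪ supp (a f₀) W)
      (((Finset.card_union_le _ _).trans (by omega)).trans_lt (hDb f h4))
    rw [Finset.mem_filter] at hg
    have hg1 : IsPath E (a f₀) ((a g, g) :: W) := by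
      refine ⟨hF hg.1, ha g hg.1, h5 ▸ hg.2 ▸ hb g hg.1, ?_, fun t ht ht' => ?_, h1⟩
      · rw [← h5, ← hg.2]
        exact hab g hg.1
      · rw [← h5]
        exact hgX t ht (Finset.mem_union_right _ ht')
    have hc1 := LinearPath.supp_card_le hr hg1
    rw [List.length_cons, h2, show r * (2 * k + 1 + 1) = r * (2 * k) + r + r by ring] at hc1
    obtain ⟨f', g1, g2, g3, g4⟩ := step (a f₀) ((a g, g) :: W) g hg.1 rfl hg1 (by
        intro t ht htS
        simp only [supp, Finset.mem_union] at ht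
        rcases ht with ht | ht
        · have h := hgX t ht (Finset.mem_union_left _ htS)
          exact h3 t (h ▸ h5 ▸ head_mem_supp h1) htS
        · exact h3 t ht htS) (by omega)
    refine ⟨_, g3, by simp only [List.length_cons, h2]; omega, g4, f', g1, rfl, ?_⟩
    rw [g2, hg.2, h6]

end LinearPath

/-! ### Dense systems of edges contain the cycle -/

namespace LinearPath

variable {V : Type*} [DecidableEq V] {E F : Finset (Finset V)} {x : V} {r m i ℓ : ℕ}
  {A T : Finset V} {P : V → List (V × Finset V)}

theorem IsPathSystem.marks_card_le (hr : ∀ e ∈ E, e.card = r) (hP : IsPathSystem E x i A P)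
    (him : i ≤ m) {u : V} (hu : u ∈ A) : (marks x (P u)).card ≤ r * m + 1 :=
  Finset.card_image_le.trans (hP.supp_card_le hr him hu)

/-- In a dense system of edges there are paths of all short odd lengths that start at a fixed
vertex `u` of `A` and end at vertices `w` with the same value of `κ w`. -/
theorem exists_path_of_dense (hE : Linear E) (hr : ∀ e ∈ E, e.card = r)
    (hP : IsPathSystem E x i A P) (him : i ≤ m) (hF : F ⊆ E) (a b : Finset V → V)
    (ha : ∀ f ∈ F, a f ∈ f) (haA : ∀ f ∈ F, a f ∈ A) (hb : ∀ f ∈ F, b f ∈ f)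
    (hbT : ∀ f ∈ F, b f ∈ T) (hab : ∀ f ∈ F, a f ≠ b f) (κ : V → Finset (V × ℕ))
    (hκ : ∀ f ∈ F, κ (b f) ⊆ marks x (P (a f))) {D : ℕ} (hD : 3 * r * m + 2 ≤ D)
    (hdense : D * (2 ^ (r * m + 1) * (A.card + T.card)) < F.card) :
    ∃ u ∈ A, ∃ τ ⊆ marks x (P u), ∀ k ≤ m, ∃ W, IsPath E u W ∧ W.length = 2 * k + 1 ∧
      (∀ t ∈ supp u W, t ∈ supp x (P u) → t = u) ∧ κ (head u W) = τ ∧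
      D < (F.filter fun f => b f = head u W).card := by
  -- Each edge is incident to `b f` and to the pair of `a f` and the class `κ (b f)`. The class is a
  -- subset of the marks of `P (a f)`, so at most `2 ^ (r * m + 1)` pairs belong to one vertex of
  -- `A`.
  let inc : Finset V → Finset ((V × Finset (V × ℕ)) ⊕ V) := fun f =>
    {Sum.inl (a f, κ (b f)), Sum.inr (b f)}
  have hU : F.biUnion inc ⊆
      (A.biUnion fun u => (marks x (P u)).powerset.image fun s => (u, s)).disjSum T := by
    intro v hv
    obtain ⟨f, hf, hv⟩ := Finset.mem_biUnion.1 hv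
    simp only [inc, Finset.mem_insert, Finset.mem_singleton] at hv
    rcases hv with rfl | rfl
    · rw [Finset.inl_mem_disjSum, Finset.mem_biUnion]
      exact ⟨a f, haA f hf, Finset.mem_image.2 ⟨_, Finset.mem_powerset.2 (hκ f hf), rfl⟩⟩
    · rw [Finset.inr_mem_disjSum]
      exact hbT f hf
  have hUc : (F.biUnion inc).card ≤ 2 ^ (r * m + 1) * (A.card + T.card) := by
    refine (Finset.card_le_card hU).trans ?_
    rw [Finset.card_disjSum, mul_add]
    refine Nat.add_le_add ?_ (Nat.le_mul_of_pos_left _ (by positivity))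
    rw [mul_comm]
    refine Finset.card_biUnion_le_card_mul _ _ _ fun u hu => Finset.card_image_le.trans ?_
    rw [Finset.card_powerset]
    exact Nat.pow_le_pow_right (by norm_num) (hP.marks_card_le hr him hu)
  obtain ⟨F', hF', ⟨f₀, hf₀⟩, hdeg⟩ := exists_core inc D F
    ((Nat.mul_le_mul_left D hUc).trans_lt hdense)
  have hDa : ∀ f ∈ F', D < (F'.filter fun g => a g = a f ∧ κ (b g) = κ (b f)).card := by
    intro f hf
    have := hdeg (Sum.inl (a f, κ (b f))) (Finset.mem_biUnion.2 ⟨f, hf, by simp [inc]⟩)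
    convert this using 4 with g
    simp [inc, eq_comm]
  have hDb : ∀ f ∈ F', D < (F'.filter fun g => b g = b f).card := by
    intro f hf
    have := hdeg (Sum.inr (b f)) (Finset.mem_biUnion.2 ⟨f, hf, by simp [inc]⟩)
    convert this using 4 with g
    simp [inc, eq_comm]
  have hu := haA f₀ (hF' hf₀)
  refine ⟨a f₀, hu, κ (b f₀), hκ f₀ (hF' hf₀), fun k hk => ?_⟩
  obtain ⟨W, h1, h2, h3, f, h4, h5, h6⟩ := exists_path_in_core hE hr (hF'.trans hF) a b κ
    (fun f hf => ha f (hF' hf)) (fun f hf => hb f (hF' hf)) (fun f hf => hab f (hF' hf)) hDa hDb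
    hf₀ (supp x (P (a f₀))) k (by
      have h1 := hP.supp_card_le hr him hu
      have h2 : r * (2 * k) ≤ r * (2 * m) := Nat.mul_le_mul_left _ (by omega)
      have h3 : 3 * r * m = r * (2 * m) + r * m := by ring
      omega)
  refine ⟨W, h1, h2, h3, h5 ▸ h6, (hDb f h4).trans_le (Finset.card_le_card ?_)⟩
  rw [h5]
  exact Finset.filter_subset_filter _ hF'

/-- Bound for the size of small vertex sets in the construction of a cycle. -/
def sizeBound (r m : ℕ) : ℕ := 2 * (3 * r * m + 2)

/-- The inverse of the fraction that counts as a concentration. -/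
def spreadBound (r m : ℕ) : ℕ := 2 * ((3 * r * m + 2) * (2 * m + 1))

/-- The density that guarantees a cycle. -/
def densityBound (r m : ℕ) : ℕ :=
  spreadBound r m ^ (r * m + 1) * (spreadBound r m ^ (r * m + 1) *
    (sizeBound r m * 2 ^ (r * m + 1)) + sizeBound r m)

theorem one_le_spreadBound (r m : ℕ) : 1 ≤ spreadBound r m := by
  unfold spreadBound
  exact Nat.succ_le_of_lt (by positivity)

/-- A dense system of edges that leave `A` towards `T` gives a cycle of length `2 * m`. -/
theorem hasCycle_even_of_dense (hE : Linear E) (hr : ∀ e ∈ E, e.card = r)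
    (hP : IsPathSystem E x i A P) (him : i + 1 ≤ m) (hF : F ⊆ E) (a b : Finset V → V)
    (ha : ∀ f ∈ F, a f ∈ f) (haA : ∀ f ∈ F, a f ∈ A)
    (haP : ∀ f ∈ F, ∀ t ∈ f, t ∈ supp x (P (a f)) → t = a f) (hb : ∀ f ∈ F, b f ∈ f)
    (hbT : ∀ f ∈ F, b f ∈ T) (hab : ∀ f ∈ F, a f ≠ b f)
    (hdense : densityBound r m * (A.card + T.card) < F.card) : HasCycle E (2 * m) := by
  have hB := one_le_spreadBound r m
  obtain ⟨κ, F', hF', hκ, hc, hspread⟩ := exists_spread_fibres b (fun f => marks x (P (a f)))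
    hB F (fun f hf => hP.marks_card_le hr (by omega : i ≤ m) (haA f hf))
  have hdense' : sizeBound r m * (2 ^ (r * m + 1) * (A.card + T.card)) < F'.card := by
    have h1 := hdense.trans_le hc
    rw [densityBound, mul_assoc] at h1
    have h2 := Nat.lt_of_mul_lt_mul_left h1
    have h3 : 1 ≤ spreadBound r m ^ (r * m + 1) := Nat.one_le_pow _ _ hB
    have h4 := Nat.mul_le_mul_right (sizeBound r m * (2 ^ (r * m + 1) * (A.card + T.card))) h3
    nlinarith [Nat.zero_le (sizeBound r m * (A.card + T.card))]
  obtain ⟨u, hu, τ, hτ, hpath⟩ := exists_path_of_dense hE hr hP (by omega : i ≤ m)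
    (hF'.trans hF) a b (fun f hf => ha f (hF' hf)) (fun f hf => haA f (hF' hf))
    (fun f hf => hb f (hF' hf)) (fun f hf => hbT f (hF' hf)) (fun f hf => hab f (hF' hf)) κ hκ
    (by unfold sizeBound; omega) hdense'
  have hh : meetLength τ ≤ i := (meetLength_le hτ).trans_eq (hP u hu).2.2
  -- With `h = meetLength τ ≤ m - 1`, the path has `2 * (m - 1 - h) + 1` edges; the last edge and
  -- the two path segments of length `h` bring the total to `2 * m`.
  obtain ⟨W, h1, h2, h3, h4, h5⟩ := hpath (m - 1 - meetLength τ) (by omega)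
  have hN : ∀ f ∈ F'.filter (fun f => b f = head u W), f ∈ F' ∧ b f = head u W := fun f hf =>
    Finset.mem_filter.1 hf
  have := hasCycle_of_spread (N := F'.filter fun f => b f = head u W) (τ := τ) hE hr hP
    (by omega : i ≤ m) le_rfl hu h1 (by omega) h3 a
    ((Finset.filter_subset _ _).trans (hF'.trans hF))
    (fun f hf => (hN f hf).2 ▸ hb f (hF' (hN f hf).1))
    (fun f hf => ha f (hF' (hN f hf).1)) (fun f hf => haA f (hF' (hN f hf).1))
    (fun f hf => (hN f hf).2 ▸ hab f (hF' (hN f hf).1))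
    (fun f hf => haP f (hF' (hN f hf).1)) h5
    (fun f hf => by
      have := hκ f (hN f hf).1
      rwa [(hN f hf).2, h4] at this)
    (h4 ▸ hspread (head u W)) (fun t j ht _ _ => hτ ht)
  rw [Finset.inter_eq_left.2 hτ, h2] at this
  convert this using 1
  omega

/-- A dense system of edges that leave `A` towards `T` gives a cycle of length `2 * m + 1`. -/
theorem hasCycle_odd_of_dense (hE : Linear E) (hr : ∀ e ∈ E, e.card = r)
    (hP : IsPathSystem E x i A P) (him : i + 1 ≤ m) (hF : F ⊆ E) (a b c : Finset V → V)
    (ha : ∀ f ∈ F, a f ∈ f) (haA : ∀ f ∈ F, a f ∈ A)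
    (haP : ∀ f ∈ F, ∀ t ∈ f, t ∈ supp x (P (a f)) → t = a f) (hb : ∀ f ∈ F, b f ∈ f)
    (hbT : ∀ f ∈ F, b f ∈ T) (hab : ∀ f ∈ F, a f ≠ b f) (hcf : ∀ f ∈ F, c f ∈ f)
    (hcT : ∀ f ∈ F, c f ∈ T) (hac : ∀ f ∈ F, a f ≠ c f) (hbc : ∀ f ∈ F, b f ≠ c f)
    (hdense : densityBound r m * (A.card + T.card) < F.card) : HasCycle E (2 * m + 1) := by
  have hB := one_le_spreadBound r m
  have hi : i ≤ m := by omega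
  obtain ⟨σ, F₁, hF₁, hσ, hc₁, hspread₁⟩ := exists_spread_fibres c (fun f => marks x (P (a f)))
    hB F (fun f hf => hP.marks_card_le hr hi (haA f hf))
  -- Keeping only edges in large fibres of `c` ensures that, once `c f` is reached, many edges of
  -- `F₁` are available there for the final step.
  have hc₂ := card_le_card_filter_add c F₁ T (fun f hf => hcT f (hF₁ hf)) (sizeBound r m)
  set F₂ := F₁.filter fun f => sizeBound r m < (F₁.filter fun g => c g = c f).card
  have hF₂ : F₂ ⊆ F₁ := Finset.filter_subset _ _
  -- The second spreading concerns the common sets `σ (c f)` and not the marks of single paths: the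
  -- final path belongs to another edge at `c f` and shares only `σ (c f)` with the rest of its
  -- fibre.
  obtain ⟨κ, F₃, hF₃, hκ, hc₃, hspread₃⟩ := exists_spread_fibres b (fun f => σ (c f)) hB F₂
    (fun f hf => (Finset.card_le_card (hσ f (hF₂ hf))).trans
      (hP.marks_card_le hr hi (haA f (hF₁ (hF₂ hf)))))
  have hF₃₁ := hF₃.trans hF₂
  have hF₃F := hF₃₁.trans hF₁
  have hdense' : sizeBound r m * (2 ^ (r * m + 1) * (A.card + T.card)) < F₃.card := by
    have h1 := hdense.trans_le hc₁
    rw [densityBound, mul_assoc] at h1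
    have h2 := Nat.lt_of_mul_lt_mul_left h1
    refine Nat.lt_of_mul_lt_mul_left (a := spreadBound r m ^ (r * m + 1)) ?_
    nlinarith [Nat.zero_le (sizeBound r m * A.card)]
  obtain ⟨u, hu, τ, hτ, hpath⟩ := exists_path_of_dense hE hr hP hi
    (hF₃F.trans hF) a b (fun f hf => ha f (hF₃F hf)) (fun f hf => haA f (hF₃F hf))
    (fun f hf => hb f (hF₃F hf)) (fun f hf => hbT f (hF₃F hf)) (fun f hf => hab f (hF₃F hf)) κ
    (fun f hf => (hκ f hf).trans (hσ f (hF₃₁ hf)))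
    (by unfold sizeBound; omega) hdense'
  have hh : meetLength τ ≤ i := (meetLength_le hτ).trans_eq (hP u hu).2.2
  obtain ⟨W, h1, h2, h3, h4, h5⟩ := hpath (m - 1 - meetLength τ) (by omega)
  have hXc : (supp u W ∪ supp x (P u)).card ≤ 3 * r * m + 2 := by
    refine (Finset.card_union_le _ _).trans ?_
    have g1 := LinearPath.supp_card_le hr h1
    have g2 := hP.supp_card_le hr hi hu
    have g3 : r * W.length ≤ r * (2 * m) := Nat.mul_le_mul_left _ (by omega)
    have g4 : 3 * r * m = r * (2 * m) + r * m := by ring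
    omega
  obtain ⟨f, hf, hfX, hfτ⟩ := exists_avoiding_spread (N := F₃.filter fun f => b f = head u W) hE
    ((Finset.filter_subset _ _).trans (hF₃F.trans hF)) (head u W)
    (fun f hf => (Finset.mem_filter.1 hf).2 ▸ hb f (hF₃F (Finset.mem_filter.1 hf).1))
    (supp u W ∪ supp x (P u)) (by unfold sizeBound at h5; omega) (fun f => σ (c f)) τ
    ((supp u W ∪ supp x (P u)) ×ˢ Finset.range (2 * m + 1)) hB (by
      rw [Finset.card_product, Finset.card_range]
      exact Nat.mul_le_mul_left _ (Nat.mul_le_mul_right _ hXc)) (h4 ▸ hspread₃ (head u W))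
  obtain ⟨hf3, hfb⟩ := Finset.mem_filter.1 hf
  have hfF := hF₃F hf3
  have hfκ : τ ⊆ σ (c f) := by
    have := hκ f hf3
    rwa [hfb, h4] at this
  have hfσ := hσ f (hF₃₁ hf3)
  obtain ⟨q1, q2, q3⟩ := hP (a f) (haA f hfF)
  have hστ : ∀ t j, (t, j) ∈ σ (c f) → t ∈ supp u W ∪ supp x (P u) → (t, j) ∈ τ := by
    intro t j ht htX
    refine hfτ _ ht (Finset.mem_product.2 ⟨htX, Finset.mem_range.2 ?_⟩)
    have g1 := (mem_marks.1 (hfσ ht)).2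
    have g2 := lab_le x (P (a f)) t
    dsimp only
    omega
  have hcX : c f ∉ supp u W ∪ supp x (P u) := fun h =>
    hbc f hfF (hfb.trans (hfX _ (hcf f hfF) h).symm)
  have hW' : IsPath E u ((c f, f) :: W) := by
    refine ⟨hF hfF, hcf f hfF, hfb ▸ hb f hfF, ?_, fun t ht ht' =>
      hfX t ht (Finset.mem_union_left _ ht'), h1⟩
    rw [← hfb]
    exact (hbc f hfF).symm
  have hN : ∀ g ∈ F₁.filter (fun g => c g = c f), g ∈ F₁ ∧ c g = c f := fun g hg =>
    Finset.mem_filter.1 hg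
  -- The extra edge leaves the meeting point unchanged, so the cycle is exactly one edge longer than
  -- in the even case.
  have hfin : σ (c f) ∩ marks x (P u) = τ := by
    ext ⟨t, j⟩
    rw [Finset.mem_inter]
    constructor
    · rintro ⟨g1, g2⟩
      exact hστ t j g1 (Finset.mem_union_right _ (mem_marks.1 g2).1)
    · exact fun g => ⟨hfκ g, hτ g⟩
  have := hasCycle_of_spread (N := F₁.filter fun g => c g = c f) (τ := σ (c f)) hE hr hP
    hi le_rfl hu hW' (by simp only [List.length_cons]; omega) ?_ a
    ((Finset.filter_subset _ _).trans (hF₁.trans hF))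
    (fun g hg => by
      change c f ∈ g
      exact (hN g hg).2 ▸ hcf g (hF₁ (hN g hg).1))
    (fun g hg => ha g (hF₁ (hN g hg).1)) (fun g hg => haA g (hF₁ (hN g hg).1))
    (fun g hg => by
      change a g ≠ c f
      exact (hN g hg).2 ▸ hac g (hF₁ (hN g hg).1))
    (fun g hg => haP g (hF₁ (hN g hg).1)) (Finset.mem_filter.1 (hF₃ hf3)).2
    (fun g hg => by
      have := hσ g (hN g hg).1
      rwa [(hN g hg).2] at this)
    (hspread₁ (c f)) ?_
  · rw [hfin, List.length_cons, h2] at this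
    convert this using 1
    omega
  · intro t ht ht'
    simp only [supp, Finset.mem_union] at ht
    rcases ht with ht | ht
    · have := hfX t ht (Finset.mem_union_right _ ht')
      exact h3 t (this ▸ head_mem_supp h1) ht'
    · exact h3 t ht ht'
  · intro t j ht hj htX
    simp only [supp, Finset.union_assoc] at htX
    -- On the extra edge `f` itself, the path from `a f` has only its first vertex, at position 0.
    rcases Finset.mem_union.1 htX with htf | htX
    · obtain ⟨g1, g2⟩ := mem_marks.1 (hfσ ht)
      have g3 := haP f hfF t htf g1
      exact absurd (g2 ▸ lab_eq_zero (g3.trans q2.symm)) hj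
    · exact hτ (hστ t j ht htX)

end LinearPath

/-! ### Growth of the reachable sets and the edge bound -/

namespace LinearPath

variable {V : Type*} [DecidableEq V] {E F : Finset (Finset V)} {x : V} {r m i ℓ : ℕ}

theorem HasCycle.mono (h : HasCycle F ℓ) (hFE : F ⊆ E) : HasCycle E ℓ := by
  obtain ⟨e, h1, h2⟩ := h
  exact ⟨e, fun i hi => hFE (h1 i hi), h2⟩

open Classical in
/-- The vertices with a linear path of length `i` to `x`. -/
noncomputable def reach [Fintype V] (E : Finset (Finset V)) (x : V) (i : ℕ) : Finset V :=
  Finset.univ.filter fun v => ∃ p, IsPath E x p ∧ head x p = v ∧ p.length = i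

theorem mem_reach [Fintype V] {v : V} :
    v ∈ reach E x i ↔ ∃ p, IsPath E x p ∧ head x p = v ∧ p.length = i := by
  simp [reach]

theorem reach_subset [Fintype V] (hx : x ∈ E.biUnion id) : reach E x i ⊆ E.biUnion id := by
  intro v hv
  obtain ⟨p, h1, rfl, -⟩ := mem_reach.1 hv
  cases p with
  | nil => exact hx
  | cons a p => exact Finset.mem_biUnion.2 ⟨a.2, h1.1, h1.2.1⟩

/-- Without a cycle, the number of vertices reachable by linear paths grows quickly. -/
theorem card_reach_mul_le [Fintype V] (hE : Linear E) (hr : ∀ e ∈ E, e.card = r) (hr3 : 3 ≤ r)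
    (hℓ : ℓ = 2 * m ∨ ℓ = 2 * m + 1) (hcyc : ¬ HasCycle E ℓ) (hx : x ∈ E.biUnion id) {d : ℕ}
    (hd : ∀ v ∈ E.biUnion id, d ≤ (E.filter fun f => v ∈ f).card) (him : i + 1 ≤ m) :
    (reach E x i).card * d ≤ r * densityBound r m * ((reach E x i).card + (reach E x (i + 1)).card)
      + (reach E x i).card * (r * m + 1) := by
  classical
  set A := reach E x i with hA
  set T := reach E x (i + 1) with hT
  have hex : ∀ v, ∃ p, v ∈ A → IsPath E x p ∧ head x p = v ∧ p.length = i := by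
    intro v
    by_cases hv : v ∈ A
    · obtain ⟨p, hp⟩ := mem_reach.1 hv
      exact ⟨p, fun _ => hp⟩
    · exact ⟨[], fun h => absurd h hv⟩
  choose P hP using hex
  have hPS : IsPathSystem E x i A P := hP
  let good : V → Finset V → Prop := fun v f => v ∈ f ∧ ∀ t ∈ f, t ∈ supp x (P v) → t = v
  set F := E.filter fun f => ∃ v ∈ A, good v f with hFdef
  have hFE : F ⊆ E := Finset.filter_subset _ _
  -- Double counting of good pairs: a vertex of `A` loses at most one edge per vertex of its path,
  -- and an edge is counted at most once per vertex.
  have hcount : A.card * d ≤ r * F.card + A.card * (r * m + 1) := by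
    have h1 : ∀ v ∈ A, d ≤ (F.bipartiteAbove good v).card + (r * m + 1) := by
      intro v hv
      have g1 := hd v (reach_subset hx hv)
      have g2 := card_hitting_le (N := E.filter fun f => v ∈ f) hE (Finset.filter_subset _ _) v
        (fun f hf => (Finset.mem_filter.1 hf).2) (supp x (P v))
      have g3 := hPS.supp_card_le hr (by omega : i ≤ m) hv
      have g4 : (E.filter fun f => v ∈ f) ⊆ F.bipartiteAbove good v ∪
          (E.filter fun f => v ∈ f).filter fun f => ∃ t ∈ f, t ∈ supp x (P v) ∧ t ≠ v := by
        intro f hf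
        obtain ⟨hfE, hvf⟩ := Finset.mem_filter.1 hf
        by_cases hgood : good v f
        · exact Finset.mem_union_left _ ((Finset.mem_bipartiteAbove good).2
            ⟨Finset.mem_filter.2 ⟨hfE, v, hv, hgood⟩, hgood⟩)
        · refine Finset.mem_union_right _ (Finset.mem_filter.2 ⟨hf, ?_⟩)
          by_contra! hcon
          exact hgood ⟨hvf, hcon⟩
      have g5 := (Finset.card_le_card g4).trans (Finset.card_union_le _ _)
      omega
    have h2 := Finset.sum_card_bipartiteAbove_eq_sum_card_bipartiteBelow (s := A) (t := F) good
    have h3 : ∑ f ∈ F, (A.bipartiteBelow good f).card ≤ r * F.card := by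
      rw [mul_comm, ← smul_eq_mul]
      refine Finset.sum_le_card_nsmul _ _ _ fun f hf => ?_
      rw [← hr f (hFE hf)]
      refine Finset.card_le_card fun v hv => ?_
      exact ((Finset.mem_bipartiteBelow good).1 hv).2.1
    calc A.card * d = ∑ v ∈ A, d := by rw [Finset.sum_const, smul_eq_mul]
      _ ≤ ∑ v ∈ A, ((F.bipartiteAbove good v).card + (r * m + 1)) := Finset.sum_le_sum h1
      _ = ∑ f ∈ F, (A.bipartiteBelow good f).card + A.card * (r * m + 1) := by
          rw [Finset.sum_add_distrib, h2, Finset.sum_const, smul_eq_mul]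
      _ ≤ _ := Nat.add_le_add_right h3 _
  have habc : ∀ f : Finset V, ∃ a b c : V, f ∈ F → (a ∈ A ∧ good a f) ∧ b ∈ f ∧ c ∈ f ∧
      a ≠ b ∧ a ≠ c ∧ b ≠ c := by
    intro f
    by_cases hf : f ∈ F
    · obtain ⟨hfE, a, ha, hg⟩ := Finset.mem_filter.1 hf
      have h1 : 1 < (f.erase a).card := by
        rw [Finset.card_erase_of_mem hg.1, hr f hfE]
        omega
      obtain ⟨b, hb, c, hc, hbc⟩ := Finset.one_lt_card.1 h1
      rw [Finset.mem_erase] at hb hc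
      exact ⟨a, b, c, fun _ => ⟨⟨ha, hg⟩, hb.2, hc.2, hb.1.symm, hc.1.symm, hbc⟩⟩
    · exact ⟨x, x, x, fun h => absurd h hf⟩
  choose a b c habc using habc
  -- Prepending `f` to the path of `a f` gives a linear path because `f` meets that path only in `a
  -- f`.
  have hreach : ∀ f ∈ F, ∀ v ∈ f, a f ≠ v → v ∈ T := by
    intro f hf v hv hav
    obtain ⟨⟨h1, h2⟩, -⟩ := habc f hf
    obtain ⟨g1, g2, g3⟩ := hP (a f) h1
    refine mem_reach.2 ⟨(v, f) :: P (a f), ⟨hFE hf, hv, g2.symm ▸ h2.1, g2.symm ▸ hav.symm, ?_, g1⟩,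
      rfl, by rw [List.length_cons, g3]⟩
    rw [g2]
    exact h2.2
  have hsparse : F.card ≤ densityBound r m * (A.card + T.card) := by
    by_contra hlt
    rw [not_le] at hlt
    refine hcyc ?_
    rcases hℓ with rfl | rfl
    · exact hasCycle_even_of_dense hE hr hPS him hFE a b (fun f hf => (habc f hf).1.2.1)
        (fun f hf => (habc f hf).1.1) (fun f hf => (habc f hf).1.2.2)
        (fun f hf => (habc f hf).2.1)
        (fun f hf => hreach f hf _ (habc f hf).2.1 (habc f hf).2.2.2.1)
        (fun f hf => (habc f hf).2.2.2.1) hlt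
    · exact hasCycle_odd_of_dense hE hr hPS him hFE a b c (fun f hf => (habc f hf).1.2.1)
        (fun f hf => (habc f hf).1.1) (fun f hf => (habc f hf).1.2.2)
        (fun f hf => (habc f hf).2.1)
        (fun f hf => hreach f hf _ (habc f hf).2.1 (habc f hf).2.2.2.1)
        (fun f hf => (habc f hf).2.2.2.1) (fun f hf => (habc f hf).2.2.1)
        (fun f hf => hreach f hf _ (habc f hf).2.2.1 (habc f hf).2.2.2.2.1)
        (fun f hf => (habc f hf).2.2.2.2.1) (fun f hf => (habc f hf).2.2.2.2.2) hlt
  have := Nat.mul_le_mul_left r hsparse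
  rw [← mul_assoc] at this
  omega

/-- The constant in the bound for the minimum degree. -/
def degreeBound (r m : ℕ) : ℕ := 2 * (r * densityBound r m + (r * m + 1))

theorem degree_pow_le [Fintype V] (hE : Linear E) (hr : ∀ e ∈ E, e.card = r) (hr3 : 3 ≤ r)
    (hℓ : ℓ = 2 * m ∨ ℓ = 2 * m + 1) (hcyc : ¬ HasCycle E ℓ) (hx : x ∈ E.biUnion id) {d : ℕ}
    (hd : ∀ v ∈ E.biUnion id, d ≤ (E.filter fun f => v ∈ f).card) :
    d ^ m ≤ degreeBound r m ^ m * Fintype.card V := by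
  have hV : 1 ≤ Fintype.card V := Fintype.card_pos_iff.2 ⟨x⟩
  rcases le_total d (degreeBound r m) with hle | hle
  · exact (Nat.pow_le_pow_left hle m).trans (Nat.le_mul_of_pos_right _ hV)
  have key : ∀ i ≤ m, d ^ i ≤ degreeBound r m ^ i * (reach E x i).card := by
    intro i
    induction i with
    | zero =>
      intro _
      have : (reach E x 0).Nonempty := ⟨x, mem_reach.2 ⟨[], trivial, rfl, rfl⟩⟩
      simpa using this.card_pos
    | succ i ih =>
      intro hi
      have h1 := ih (by omega)
      have h2 := card_reach_mul_le hE hr hr3 hℓ hcyc hx hd hi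
      -- `degreeBound` is twice the coefficient of `(reach E x i).card` on the right of `h2`, so for
      -- larger `d` these terms are at most half of the left side.
      have h3 : (reach E x i).card * d ≤ degreeBound r m * (reach E x (i + 1)).card := by
        unfold degreeBound at hle ⊢
        have h4 := Nat.mul_le_mul_left (reach E x i).card hle
        nlinarith [Nat.zero_le ((r * m + 1) * (reach E x (i + 1)).card)]
      calc d ^ (i + 1) = d ^ i * d := pow_succ _ _
        _ ≤ (degreeBound r m ^ i * (reach E x i).card) * d := Nat.mul_le_mul_right _ h1
        _ = degreeBound r m ^ i * ((reach E x i).card * d) := mul_assoc _ _ _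
        _ ≤ degreeBound r m ^ i * (degreeBound r m * (reach E x (i + 1)).card) :=
            Nat.mul_le_mul_left _ h3
        _ = _ := by rw [pow_succ, mul_assoc]
  exact (key m le_rfl).trans (Nat.mul_le_mul_left _ (Finset.card_le_univ _))

/-- The number of edges of a linear `r`-graph without a linear cycle of length `ℓ`. -/
theorem card_pow_le_of_not_hasCycle [Fintype V] (hE : Linear E) (hr : ∀ e ∈ E, e.card = r)
    (hr3 : 3 ≤ r) (hm : 1 ≤ m) (hℓ : ℓ = 2 * m ∨ ℓ = 2 * m + 1) (hcyc : ¬ HasCycle E ℓ) :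
    E.card ^ m ≤ degreeBound r m ^ m * Fintype.card V ^ (m + 1) := by
  rcases E.eq_empty_or_nonempty with rfl | ⟨e, he⟩
  · rw [Finset.card_empty, zero_pow (by omega)]
    exact Nat.zero_le _
  have hEpos : 0 < E.card := Finset.card_pos.2 ⟨e, he⟩
  have hne : e.Nonempty := Finset.card_pos.1 (by rw [hr e he]; omega)
  obtain ⟨w, -⟩ := hne
  have hV : 0 < Fintype.card V := Fintype.card_pos_iff.2 ⟨w⟩
  set n := Fintype.card V
  -- Subtracting 1 makes `D * n < E.card` strict, as the core requires; core degrees are then at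
  -- least `D + 1`, and `(D + 1) * n` still bounds `E.card`.
  set D := (E.card - 1) / n with hD
  have hDn : D * n ≤ E.card - 1 := Nat.div_mul_le_self _ _
  have hDn' : E.card ≤ (D + 1) * n := by
    have := Nat.lt_mul_div_succ (E.card - 1) hV
    rw [mul_comm] at this
    change E.card - 1 < (D + 1) * n at this
    omega
  obtain ⟨E', hE', ⟨f, hf⟩, hdeg⟩ := exists_core id D E (by
    have := Nat.mul_le_mul_left D (Finset.card_le_univ (E.biUnion id))
    change D * (E.biUnion id).card ≤ D * n at this
    omega)
  obtain ⟨x, hx⟩ : f.Nonempty := Finset.card_pos.1 (by rw [hr f (hE' hf)]; omega)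
  have h := degree_pow_le (E := E') (d := D + 1) (x := x)
    (fun e he f hf => hE e (hE' he) f (hE' hf)) (fun e he => hr e (hE' he)) hr3 hℓ
    (fun h => hcyc (h.mono hE')) (Finset.mem_biUnion.2 ⟨f, hf, hx⟩) hdeg
  calc E.card ^ m ≤ ((D + 1) * n) ^ m := Nat.pow_le_pow_left hDn' m
    _ = (D + 1) ^ m * n ^ m := mul_pow _ _ _
    _ ≤ (degreeBound r m ^ m * n) * n ^ m := Nat.mul_le_mul_right _ h
    _ = _ := by ring

end LinearPath

/-! ### Translation to hypergraphs -/

namespace Hypergraph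

open LinearPath

/-- Indices pass to `ZMod ℓ` through `ZMod.val`; the wrap-around pair is the only one treated
separately. Distinctness of the edges follows from intersections of size 0 or 1, as `r ≥ 2`. -/
theorem containsLinearCycle_of_hasCycle {V : Type*} [DecidableEq V] {G : Hypergraph V}
    {E : Finset (Finset V)} {r ℓ : ℕ} (hE : ∀ e ∈ E, (e : Set V) ∈ G.edgeSet) (hr3 : 2 ≤ r)
    (hℓ : 3 ≤ ℓ) (hr : ∀ e ∈ E, e.card = r) (h : HasCycle E ℓ) :
    G.ContainsLinearCycle r ℓ := by
  obtain ⟨e, h1, h2, h3, h4, h5⟩ := h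
  have : NeZero ℓ := ⟨by omega⟩
  have hval : ∀ i : ZMod ℓ, i.val < ℓ := fun i => ZMod.val_lt i
  have hsucc : ∀ i : ZMod ℓ, i.val + 1 < ℓ → (i + 1).val = i.val + 1 := by
    intro i hi
    have h1 : (1 : ZMod ℓ).val = 1 := ZMod.val_one'' (by omega)
    rw [ZMod.val_add_of_lt (by rwa [h1]), h1]
  have hlast : ∀ i : ZMod ℓ, i.val + 1 = ℓ → (i + 1).val = 0 := by
    intro i hi
    have h1 : (1 : ZMod ℓ).val = 1 := ZMod.val_one'' (by omega)
    rw [ZMod.val_add, h1, hi, Nat.mod_self]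
  have hinter : ∀ i : ZMod ℓ, (e i.val ∩ e (i + 1).val).card = 1 := by
    intro i
    rcases lt_or_eq_of_le (Nat.succ_le_of_lt (hval i)) with hi | hi
    · rw [hsucc i hi]
      exact h2 _ hi
    · rw [hlast i hi, show i.val = ℓ - 1 by omega]
      exact h3
  have hdisj : ∀ i j : ZMod ℓ, i.val < j.val → j ≠ i + 1 → i ≠ j + 1 →
      Disjoint (e i.val) (e j.val) := by
    intro i j hij hji hij'
    have hj := hval j
    refine h4 _ _ ?_ hj ?_
    · refine lt_of_le_of_ne hij fun hne => hji (ZMod.val_injective ℓ ?_)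
      rw [hsucc i (by omega), ← hne]
    · rintro ⟨hi0, hjl⟩
      refine hij' (ZMod.val_injective ℓ ?_)
      rw [hlast j hjl, hi0]
  have hdisj' : ∀ i j : ZMod ℓ, i ≠ j → j ≠ i + 1 → i ≠ j + 1 →
      Disjoint (e i.val) (e j.val) := by
    intro i j hij hji hij'
    rcases lt_or_gt_of_ne (fun h => hij (ZMod.val_injective ℓ h)) with hlt | hlt
    · exact hdisj i j hlt hji hij'
    · exact (hdisj j i hlt hij' hji).symm
  have hcard : ∀ i : ZMod ℓ, (e i.val).card = r := fun i => hr _ (h1 _ (hval i))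
  have hinj : Function.Injective fun i : ZMod ℓ => (e i.val : Set V) := by
    intro i j hij
    have hij : e i.val = e j.val := Finset.coe_injective hij
    by_contra hne
    have hi := hcard i
    by_cases hji : j = i + 1
    · have := hinter i
      rw [← hji, ← hij, Finset.inter_self] at this
      omega
    by_cases hij' : i = j + 1
    · have := hinter j
      rw [← hij', ← hij, Finset.inter_self] at this
      omega
    have := hdisj' i j hne hji hij'
    rw [← hij, disjoint_self, Finset.bot_eq_empty] at this
    rw [this, Finset.card_empty] at hi
    omega
  have htriple : ∀ i j k : ZMod ℓ, i.val < j.val → j.val < k.val →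
      ∀ t, t ∈ e i.val → t ∈ e j.val → t ∈ e k.val → False := by
    intro i j k hij hjk t hi hj hk
    have : t ∈ e i.val ∩ e j.val ∩ e k.val := by simp [hi, hj, hk]
    rw [h5 _ _ _ hij hjk (hval k)] at this
    simp at this
  let C : Hypergraph V :=
    { vertexSet := ⋃ i : ZMod ℓ, (e i.val : Set V)
      edgeSet := Set.range fun i : ZMod ℓ => (e i.val : Set V)
      subset_vertexSet_of_mem_edgeSet' := by
        rintro _ ⟨i, rfl⟩
        exact Set.subset_iUnion (fun i : ZMod ℓ => (e i.val : Set V)) i }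
  refine ⟨C, ⟨?_, ?_⟩, ?_, fun i : ZMod ℓ => (e i.val : Set V), hinj, rfl, rfl, ?_, ?_, ?_⟩
  · exact Set.iUnion_subset fun i => G.subset_vertexSet_of_mem_edgeSet' (hE _ (h1 _ (hval i)))
  · rintro _ ⟨i, rfl⟩
    exact hE _ (h1 _ (hval i))
  · rintro _ ⟨i, rfl⟩
    change (e i.val : Set V).encard = r
    rw [Set.encard_coe_eq_coe_finsetCard, hcard]
  · intro i
    change ((e i.val : Set V) ∩ (e (i + 1).val : Set V)).encard = 1
    rw [← Finset.coe_inter, Set.encard_coe_eq_coe_finsetCard, hinter, Nat.cast_one]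
  · intro i j hij hji hij'
    exact Finset.disjoint_coe.2 (hdisj' i j hij hji hij')
  · intro i j k hij hjk hik
    rw [Set.eq_empty_iff_forall_notMem]
    rintro t ⟨⟨hi, hj⟩, hk⟩
    have n1 : i.val ≠ j.val := fun h => hij (ZMod.val_injective ℓ h)
    have n2 : j.val ≠ k.val := fun h => hjk (ZMod.val_injective ℓ h)
    have n3 : i.val ≠ k.val := fun h => hik (ZMod.val_injective ℓ h)
    rcases lt_or_gt_of_ne n1 with g1 | g1 <;> rcases lt_or_gt_of_ne n2 with g2 | g2 <;>
      rcases lt_or_gt_of_ne n3 with g3 | g3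
    · exact htriple i j k g1 g2 t hi hj hk
    · omega
    · exact htriple i k j g3 g2 t hi hk hj
    · exact htriple k i j g3 g1 t hk hi hj
    · exact htriple j i k g1 g3 t hj hi hk
    · exact htriple j k i g2 g3 t hj hk hi
    · omega
    · exact htriple k j i g2 g1 t hk hj hi

theorem ncard_edgeSet_pow_le {V : Type*} [Fintype V] {G : Hypergraph V} {r ℓ m : ℕ} (hr : 3 ≤ r)
    (hℓ : 3 ≤ ℓ) (hm : ℓ = 2 * m ∨ ℓ = 2 * m + 1) (hu : G.IsUniform r) (hl : G.IsLinear)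
    (hc : ¬ G.ContainsLinearCycle r ℓ) :
    G.edgeSet.ncard ^ m ≤ degreeBound r m ^ m * Fintype.card V ^ (m + 1) := by
  classical
  set E : Finset (Finset V) := Finset.univ.filter fun e => (e : Set V) ∈ G.edgeSet with hEdef
  have hE : ∀ e ∈ E, (e : Set V) ∈ G.edgeSet := fun e he => (Finset.mem_filter.1 he).2
  have hcard : G.edgeSet.ncard = E.card := by
    have : G.edgeSet = (fun e : Finset V => (e : Set V)) '' (E : Set (Finset V)) := by
      ext s
      constructor
      · intro hs
        refine ⟨s.toFinset, ?_, by simp⟩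
        simp [hEdef, hs]
      · rintro ⟨e, he, rfl⟩
        exact hE e he
    rw [this, Set.ncard_image_of_injective _ Finset.coe_injective, Set.ncard_coe_finset]
  have hEr : ∀ e ∈ E, e.card = r := by
    intro e he
    have := hu _ (hE e he)
    rw [Set.encard_coe_eq_coe_finsetCard] at this
    exact_mod_cast this
  have hElin : Linear E := by
    intro e he f hf v w hvw hve hwe hvf hwf
    by_contra hne
    have := hl _ (hE e he) _ (hE f hf) (fun h => hne (Finset.coe_injective h))
    exact hvw (Set.encard_le_one_iff.1 this v w ⟨hve, hvf⟩ ⟨hwe, hwf⟩)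
  rw [hcard]
  exact card_pow_le_of_not_hasCycle hElin hEr hr (by omega) hm fun h =>
    hc (containsLinearCycle_of_hasCycle hE (by omega) hℓ hEr h)

end Hypergraph

/-! ### Extraction of the `m`-th root -/

theorem theorem1p3 (r ℓ : ℕ) (hr : 3 ≤ r) (hℓ : 3 ≤ ℓ) :
    ∃ α : ℝ, 0 < α ∧ ∀ n : ℕ,
      (Hypergraph.linearTuranCycle n r ℓ : ℝ) ≤
        α * (n : ℝ) ^ (1 + 1 / ((ℓ / 2 : ℕ) : ℝ)) := by
  obtain ⟨m, hm⟩ : ∃ m, m = ℓ / 2 := ⟨_, rfl⟩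
  have hm1 : 1 ≤ m := by omega
  rw [← hm]
  refine ⟨LinearPath.degreeBound r m, ?_, fun n => ?_⟩
  · have : 0 < LinearPath.degreeBound r m := by
      unfold LinearPath.degreeBound
      positivity
    exact_mod_cast this
  obtain ⟨G, -, hu, hl, hc, hk⟩ := (Hypergraph.isGreatest_linearTuranCycle n r ℓ).1
  have h := Hypergraph.ncard_edgeSet_pow_le (m := m) hr hℓ (by omega) hu hl hc
  rw [hk, Fintype.card_fin] at h
  have h' : (Hypergraph.linearTuranCycle n r ℓ : ℝ) ^ m ≤
      (LinearPath.degreeBound r m : ℝ) ^ m * (n : ℝ) ^ (m + 1) := by exact_mod_cast h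
  have hm0 : (m : ℝ) ≠ 0 := by
    have : m ≠ 0 := by omega
    exact_mod_cast this
  refine le_of_pow_le_pow_left₀ (n := m) (by omega) (by positivity) (h'.trans_eq ?_)
  rw [mul_pow, ← Real.rpow_natCast ((n : ℝ) ^ (1 + 1 / (m : ℝ))) m,
    ← Real.rpow_mul (Nat.cast_nonneg n), add_mul, one_div_mul_cancel hm0, one_mul,
    ← Nat.cast_succ, Real.rpow_natCast]
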